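/- Let $G=(V,E)$ be a linear graph, i.e. a directed graph with $V=\mathbb N=\{1,2,\dots\}$ whose edge set consists of all pairs $(i,1)$ and $(i,i+1)$, $i\in\mathbb N$, together with some forward jumps $(i,j)$, $j>i+1$, only finitely many for each $i$. Let $\mathcal W:E\to(0,\infty)$. The weight of a path is the product of the weights of its edges. A simple $v$-cycle is a path of length $n\ge1$ from $v$ to $v$ that does not pass through $v$ in between; $q_v(n)$ is the sum of the weights of the simple $v$-cycles of length $n$, $\Phi_v(z)=\sum_{n\ge1}q_v(n)z^n$, and $R_v$ is the radius of convergence of $\Phi_v$. Assume that $(G,\mathcal W)$ is unstable positive: for some vertex $v$, $\Phi_v(R_v)=1$ and $\Phi_v'(R_v)=\sum_{n\ge1} n\,q_v(n)R_v^{n-1}<\infty$. For $m>n\ge1$ let $G_{n,m}$ be the smallest subgraph of $G$ containing all simple $1$-cycles of length at most $n$ and all simple $1$-cycles of length $m$. For a finite connected subgraph $H$ of $G$, a $\mathcal W$-equilibrium measure of $H$ is a shift-invariant probability measure $\mu$ carried by the two-sided infinite paths $\omega=(\omega_i)_{i\in\mathbb Z}$ in $H$ that maximizes $h(\mu)+\int\log\mathcal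 W(\omega_0,\omega_1)\,d\mu$ among all such measures, where $h(\mu)=\lim_n \frac1n H_\mu(\omega_0,\dots,\omega_{n-1})$ is the entropy of the shift. Then there is a strictly increasing sequence of positive integers $n_k$ such that the graphs $H_k=G_{n_k,n_{k+1}}$ are finite and connected, form an exhaustive sequence ($H_k\subset H_{k+1}$, and the vertex sets and edge sets of the $H_k$ have unions $V$ and $E$), and this sequence is irregular relative to $\mathcal W$: each $H_k$ has a unique $\mathcal W$-equilibrium measure $\mu_k$, and the measures $\mu_k$ tend to the zero measure, i.e. $\mu_k(C)\to0$ for every cylinder $C=\{\omega:\omega_a=w_0,\dots,\omega_{a+\ell}=w_\ell\}$, $\ell\ge0$. -/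

import Mathlib

open Filter Topology MeasureTheory
open scoped ENNReal NNReal

noncomputable section

namespace LoadedGraph

/-- A directed graph (without multiple edges) whose vertices lie in `V`, with vertex set `verts`
and edge set `{(u, v) | Adj u v}`. -/
@[ext]
structure DiGraph (V : Type*) where
  /-- the vertex set -/
  verts : Set V
  /-- `Adj u v` says that `(u, v)` is an edge, going from `u` to `v` -/
  Adj : V → V → Prop
  /-- initial vertices are vertices of the graph -/
  fst_mem : ∀ {u v : V}, Adj u v → u ∈ verts
  /-- terminal vertices are vertices of the graph -/
  snd_mem : ∀ {u v : V}, Adj u v → v ∈ verts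

namespace DiGraph

variable {V : Type*}

/-- `H` is a subgraph of `G`. -/
def IsSubgraph (H G : DiGraph V) : Prop :=
  H.verts ⊆ G.verts ∧ ∀ u v : V, H.Adj u v → G.Adj u v

/-- For all vertices `u`, `v` there is a path (of positive length) going from `u` to `v`. -/
def IsConnected (G : DiGraph V) : Prop :=
  ∀ u ∈ G.verts, ∀ v ∈ G.verts, Relation.TransGen G.Adj u v

/-- An exhaustive sequence of subgraphs of `G`. -/
def IsExhaustive (G : DiGraph V) (H : ℕ → DiGraph V) : Prop :=
  (∀ k, (H k).IsSubgraph (H (k + 1))) ∧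
    (⋃ k, (H k).verts) = G.verts ∧
    ∀ u v : V, (∃ k, (H k).Adj u v) ↔ G.Adj u v

/-- `p 0, …, p n` is a simple `v`-cycle of length `n ≥ 1` in `G`: a path from `v` to `v` that does
not pass through `v` in between. -/
def IsSimpleCycle (G : DiGraph V) (v : V) (n : ℕ) (p : Fin (n + 1) → V) : Prop :=
  1 ≤ n ∧ p 0 = v ∧ p (Fin.last n) = v ∧
    (∀ i : Fin n, G.Adj (p i.castSucc) (p i.succ)) ∧
    ∀ i : Fin (n + 1), i ≠ 0 → i ≠ Fin.last n → p i ≠ v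

/-- The weight of the path `p 0, …, p n`, the product of the weights of its edges. -/
def pathWeight (W : V → V → ℝ) {n : ℕ} (p : Fin (n + 1) → V) : ℝ :=
  ∏ i : Fin n, W (p i.castSucc) (p i.succ)

/-- `q_v(n)`: the sum of the weights of all simple `v`-cycles of length `n`. -/
def cycleSum (G : DiGraph V) (W : V → V → ℝ) (v : V) (n : ℕ) : ℝ≥0∞ :=
  ∑' p : {p : Fin (n + 1) → V // G.IsSimpleCycle v n p}, ENNReal.ofReal (pathWeight W p.1)

/-- The generating function `Φ(z) = ∑ q_v(n) zⁿ`, for `z ≥ 0`. -/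
def genFun (G : DiGraph V) (W : V → V → ℝ) (v : V) (z : ℝ≥0∞) : ℝ≥0∞ :=
  ∑' n : ℕ, G.cycleSum W v n * z ^ n

/-- The derivative `Φ'(z) = ∑ n q_v(n) zⁿ⁻¹` (at the radius of convergence: the left derivative,
finite or infinite). -/
def genFunDeriv (G : DiGraph V) (W : V → V → ℝ) (v : V) (z : ℝ≥0∞) : ℝ≥0∞ :=
  ∑' n : ℕ, (n : ℝ≥0∞) * G.cycleSum W v n * z ^ (n - 1)

/-- The radius of convergence `R_v` of `Φ`, a power series with nonnegative coefficients. -/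
def convRadius (G : DiGraph V) (W : V → V → ℝ) (v : V) : ℝ≥0∞ :=
  ⨆ (r : ℝ≥0) (_ : G.genFun W v r < ∞), (r : ℝ≥0∞)

/-- The loaded graph `(G, W)` is unstable positive. (The first equation forces `0 < R_v < ∞`.) -/
def IsUnstablePositive (G : DiGraph V) (W : V → V → ℝ) : Prop :=
  ∃ v ∈ G.verts, G.genFun W v (G.convRadius W v) = 1 ∧ G.genFunDeriv W v (G.convRadius W v) < ∞

/-- The graph generated by a family `Γ` of paths `⟨n, p⟩`, where `p 0, …, p n` are the vertices
of the path: the smallest graph containing all of them. -/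
def generated (Γ : Set (Σ n : ℕ, Fin (n + 1) → V)) : DiGraph V where
  verts := {u | ∃ γ ∈ Γ, ∃ i, γ.2 i = u}
  Adj u v := ∃ γ ∈ Γ, ∃ i : Fin γ.1, γ.2 i.castSucc = u ∧ γ.2 i.succ = v
  fst_mem := by
    rintro u v ⟨γ, hγ, i, h, -⟩
    exact ⟨γ, hγ, _, h⟩
  snd_mem := by
    rintro u v ⟨γ, hγ, i, -, h⟩
    exact ⟨γ, hγ, _, h⟩

/-- `G_{n,m}`: the subgraph of `G` generated by the simple `v`-cycles of length at most `n` and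
those of length `m`. -/
def cycleSubgraph (G : DiGraph V) (v : V) (n m : ℕ) : DiGraph V :=
  generated {γ | G.IsSimpleCycle v γ.1 γ.2 ∧ (γ.1 ≤ n ∨ γ.1 = m)}

/-- The two-sided infinite paths in `G`. -/
def pathSpace (G : DiGraph V) : Set (ℤ → V) :=
  {ω | ∀ i : ℤ, G.Adj (ω i) (ω (i + 1))}

end DiGraph

section Measures

variable {V : Type*}

/-- The shift on two-sided sequences. -/
def shift (ω : ℤ → V) : ℤ → V := fun i => ω (i + 1)

/-- The cylinder of all `ω` with `ω (a + i) = w i` for `0 ≤ i < n`. -/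
def cylinder {n : ℕ} (a : ℤ) (w : Fin n → V) : Set (ℤ → V) :=
  {ω | ∀ i : Fin n, ω (a + (i : ℕ)) = w i}

variable [MeasurableSpace V]

/-- The entropy of the distribution of `(ω 0, …, ω (n - 1))` under `μ`. -/
def blockEntropy (μ : Measure (ℤ → V)) (n : ℕ) : ℝ :=
  ∑' w : Fin n → V, Real.negMulLog (μ.real (cylinder 0 w))

/-- The entropy of the shift with respect to an invariant probability measure `μ` under which the
coordinates take finitely many values: `lim H(ω 0, …, ω (n - 1)) / n` (the limit exists by
subadditivity, so it is the upper limit). -/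
def entropy (μ : Measure (ℤ → V)) : ℝ :=
  limsup (fun n : ℕ => blockEntropy μ n / n) atTop

/-- The functional `μ ↦ h(μ) + ∫ log W(ω 0, ω 1) dμ` that equilibrium measures maximize. -/
def pressureFunctional (W : V → V → ℝ) (μ : Measure (ℤ → V)) : ℝ :=
  entropy μ + ∫ ω, Real.log (W (ω 0) (ω 1)) ∂μ

/-- The shift-invariant probability measures on the path space of `G`, regarded as measures on
the space of all sequences that are carried by the path space. -/
def invariantMeasures (G : DiGraph V) : Set (Measure (ℤ → V)) :=
  {μ | IsProbabilityMeasure μ ∧ μ.map shift = μ ∧ ∀ᵐ ω ∂μ, ω ∈ G.pathSpace}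

/-- `μ` is a `W`-equilibrium measure of the graph `G` (with finitely many vertices). -/
def IsEquilibriumMeasure (G : DiGraph V) (W : V → V → ℝ) (μ : Measure (ℤ → V)) : Prop :=
  μ ∈ invariantMeasures G ∧
    ∀ ν ∈ invariantMeasures G, pressureFunctional W ν ≤ pressureFunctional W μ

/-- Convergence of measures on the path space to the zero measure: the measure of every cylinder
(over a nonempty block of coordinates) tends to zero. -/
def TendstoZeroMeasure (μ : ℕ → Measure (ℤ → V)) : Prop :=
  ∀ (n : ℕ) (a : ℤ) (w : Fin (n + 1) → V), Tendsto (fun k => μ k (cylinder a w)) atTop (𝓝 0)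

/-- The sequence `H` of finite connected graphs, which is exhaustive in `G`, is irregular relative
to `W`: every `H k` has a unique equilibrium measure, and these measures tend to zero. -/
def IsIrregular (G : DiGraph V) (W : V → V → ℝ) (H : ℕ → DiGraph V) : Prop :=
  G.IsExhaustive H ∧ (∀ k, (H k).verts.Finite ∧ (H k).IsConnected) ∧
    ∃ μ : ℕ → Measure (ℤ → V),
      (∀ k, IsEquilibriumMeasure (H k) W (μ k) ∧
        ∀ ν, IsEquilibriumMeasure (H k) W ν → ν = μ k) ∧
      TendstoZeroMeasure μ

end Measures

/-- A linear graph on the set of positive integers: the edges are all `(i, 1)` and `(i, i + 1)`,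
and some forward jumps `(i, j)` with `j > i + 1`, finitely many out of each `i`. -/
structure IsLinear (G : DiGraph ℕ) : Prop where
  verts_eq : G.verts = {i | 1 ≤ i}
  adj_one : ∀ i, 1 ≤ i → G.Adj i 1
  adj_succ : ∀ i, 1 ≤ i → G.Adj i (i + 1)
  adj_cases : ∀ i j, G.Adj i j → j = 1 ∨ j = i + 1 ∨ i + 1 < j
  finite_jumps : ∀ i, {j | i + 1 < j ∧ G.Adj i j}.Finite

end LoadedGraph

end

/-!
Let `Φ` be the generating function of the simple `1`-cycles. If `Φ_v ≤ 1` at the radius of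
convergence `R_v` for one vertex `v`, then `R := R_1` equals `R_v` and `Φ(R) ≤ 1`, while `Φ = ∞`
beyond `R`.

The equilibrium measure of `G_{n,m}` is Parry's Markov measure, built from the positive eigenvectors
of the matrix of the weights `r * W i j`, where `r` is the point at which the generating function of
`G_{n,m}` takes the value `1`. By Kac's formula, the measure of the vertex `1` is the reciprocal of
the mean return time `∑ l * q(l) * r ^ l`. A path that is at the vertex `u` has visited `1` during
the last `u` steps, so the measures of all cylinders tend to zero if the mean return times tend to
infinity.

To make the mean return time large, note that the simple `1`-cycles of length at most `B` carry a
total weight `< 1` at `R`, hence also at some `ρ > R`. As `Φ` diverges between `R` and `ρ`, there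
are arbitrarily large `m` with `q(m) * ρ ^ m ≥ 1`, and for these `r ≤ ρ`. The new edges of `G_{n,m}`
that lie on no short cycle start late, so that `G_{n,m}` has no simple `1`-cycle of length between
`B = B(n)` and `L`, for any `L` chosen in advance of `m`. A fixed portion of the total weight `1` at
`r` is therefore carried by the cycles of length at least `L`.
-/

noncomputable section

namespace LoadedGraph

section Kernel

variable {V : Type*} {k : V → V → ℝ≥0∞} {v : V}

open Classical in
/-- The total weight of the paths of length `n` from `j` to `v` that meet `v` only at their end,
where `k i j` is the weight of a step from `i` to `j`. -/
def firstPassage (k : V → V → ℝ≥0∞) (v : V) : ℕ → V → ℝ≥0∞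
  | 0, j => if j = v then 1 else 0
  | n + 1, j => if j = v then 0 else ∑' l, k j l * firstPassage k v n l

/-- The total weight of the paths of any length from `j` to `v` that meet `v` only at their end. -/
def passageSum (k : V → V → ℝ≥0∞) (v j : V) : ℝ≥0∞ :=
  ∑' n, firstPassage k v n j

/-- The total weight of the simple `v`-cycles of any length. -/
def returnSum (k : V → V → ℝ≥0∞) (v : V) : ℝ≥0∞ :=
  ∑' l, k v l * passageSum k v l

lemma firstPassage_const_mul (z : ℝ≥0∞) (n : ℕ) (j : V) :
    firstPassage (fun i j => z * k i j) v n j = z ^ n * firstPassage k v n j := by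
  induction n generalizing j with
  | zero => simp [firstPassage]
  | succ n ih =>
    obtain rfl | hj := eq_or_ne j v
    · simp [firstPassage]
    · simp only [firstPassage, hj, if_false, ih, ← ENNReal.tsum_mul_left]
      exact tsum_congr fun l => by ring

lemma passageSum_self : passageSum k v v = 1 := by
  rw [passageSum, tsum_eq_zero_add' ENNReal.summable]
  simp [firstPassage]

lemma passageSum_of_ne {j : V} (hj : j ≠ v) :
    passageSum k v j = ∑' l, k j l * passageSum k v l := by
  rw [passageSum, tsum_eq_zero_add' ENNReal.summable]
  simp only [firstPassage, hj, if_false, zero_add, passageSum, ← ENNReal.tsum_mul_left]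
  exact ENNReal.tsum_comm

lemma mul_sum_firstPassage_le {f : V → ℝ≥0∞} (hf : ∀ j ≠ v, ∑' l, k j l * f l ≤ f j) (N : ℕ)
    (j : V) : f v * ∑ n ∈ Finset.range N, firstPassage k v n j ≤ f j := by
  induction N generalizing j with
  | zero => simp
  | succ N ih =>
    rw [Finset.sum_range_succ']
    obtain rfl | hj := eq_or_ne j v
    · simp [firstPassage]
    · calc f v * (∑ n ∈ Finset.range N, firstPassage k v (n + 1) j + firstPassage k v 0 j)
          = ∑' l, k j l * (f v * ∑ n ∈ Finset.range N, firstPassage k v n l) := by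
            simp only [firstPassage, hj, if_false, add_zero]
            rw [← Summable.tsum_finsetSum fun _ _ => ENNReal.summable, ← ENNReal.tsum_mul_left]
            exact tsum_congr fun l => by rw [← Finset.mul_sum, mul_left_comm]
        _ ≤ ∑' l, k j l * f l := by gcongr; exact ih _
        _ ≤ f j := hf j hj

lemma mul_passageSum_le {f : V → ℝ≥0∞} (hf : ∀ j ≠ v, ∑' l, k j l * f l ≤ f j) (j : V) :
    f v * passageSum k v j ≤ f j := by
  rw [passageSum, ← ENNReal.tsum_mul_left]
  refine ENNReal.summable.tsum_le_of_sum_range_le fun N => ?_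
  rw [← Finset.mul_sum]
  exact mul_sum_firstPassage_le hf N j

lemma mul_returnSum_le {f : V → ℝ≥0∞} (hf : ∀ j ≠ v, ∑' l, k j l * f l ≤ f j) :
    f v * returnSum k v ≤ ∑' l, k v l * f l := by
  rw [returnSum, ← ENNReal.tsum_mul_left]
  refine ENNReal.tsum_le_tsum fun l => ?_
  rw [mul_left_comm]
  gcongr
  exact mul_passageSum_le hf l

lemma returnSum_le_one {f : V → ℝ≥0∞} (hf : ∀ j, ∑' l, k j l * f l ≤ f j) (h0 : f v ≠ 0)
    (htop : f v ≠ ∞) : returnSum k v ≤ 1 := by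
  rw [← ENNReal.mul_le_mul_iff_right h0 htop, mul_one]
  exact (mul_returnSum_le fun j _ => hf j).trans (hf v)

lemma tsum_mul_passageSum_le (hv : returnSum k v ≤ 1) (j : V) :
    ∑' l, k j l * passageSum k v l ≤ passageSum k v j := by
  obtain rfl | hj := eq_or_ne j v
  · rwa [passageSum_self]
  · rw [passageSum_of_ne hj]

lemma passageSum_mono {k' : V → V → ℝ≥0∞} (hk : k' ≤ k) (j : V) :
    passageSum k' v j ≤ passageSum k v j := by
  have hsuper : ∀ j ≠ v, ∑' l, k' j l * passageSum k v l ≤ passageSum k v j := fun j hj => by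
    rw [passageSum_of_ne hj]
    gcongr
    exact hk j _
  simpa [passageSum_self] using mul_passageSum_le hsuper j

lemma ne_top_of_mul_le {a b c : ℝ≥0∞} (ha : a ≠ 0) (hc : c ≠ ∞) (h : a * b ≤ c) : b ≠ ∞ := by
  rintro rfl
  rw [ENNReal.mul_top ha, top_le_iff] at h
  exact hc h

lemma passageSum_ne_zero {j : V} (h : Relation.ReflTransGen (fun i l => k i l ≠ 0) j v) :
    passageSum k v j ≠ 0 := by
  induction h using Relation.ReflTransGen.head_induction_on with
  | refl => simp [passageSum_self]
  | @head j l hjl _ ih =>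
    obtain rfl | hj := eq_or_ne j v
    · simp [passageSum_self]
    · rw [passageSum_of_ne hj, Ne, ENNReal.tsum_eq_zero]
      exact fun h0 => mul_ne_zero hjl ih (h0 l)

lemma passageSum_ne_top (hv : returnSum k v ≠ ∞) {j : V}
    (h : Relation.ReflTransGen (fun i l => k i l ≠ 0) v j) : passageSum k v j ≠ ∞ := by
  induction h with
  | refl => simp [passageSum_self]
  | @tail j l _ hjl ih =>
    obtain rfl | hj := eq_or_ne j v
    · exact ne_top_of_mul_le hjl hv (ENNReal.le_tsum l)
    · exact ne_top_of_mul_le hjl ih ((ENNReal.le_tsum l).trans (passageSum_of_ne hj).ge)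

lemma returnSum_le_one_of_reflTransGen (hv : returnSum k v ≤ 1) {o : V}
    (hov : Relation.ReflTransGen (fun i l => k i l ≠ 0) o v)
    (hvo : Relation.ReflTransGen (fun i l => k i l ≠ 0) v o) : returnSum k o ≤ 1 :=
  returnSum_le_one (tsum_mul_passageSum_le hv) (passageSum_ne_zero hov)
    (passageSum_ne_top (ne_top_of_le_ne_top ENNReal.one_ne_top hv) hvo)

lemma returnSum_const_mul (z : ℝ≥0∞) :
    returnSum (fun i j => z * k i j) v =
      ∑' n, (∑' l, k v l * firstPassage k v n l) * z ^ (n + 1) := by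
  simp only [returnSum, passageSum, firstPassage_const_mul, ← ENNReal.tsum_mul_left,
    ← ENNReal.tsum_mul_right]
  rw [ENNReal.tsum_comm]
  exact tsum_congr fun n => tsum_congr fun l => by ring

lemma pow_arith_mean_le_arith_mean_pow {s t : ℝ≥0∞} (hst : s + t = 1) (x y : ℝ≥0∞) (n : ℕ) :
    (s * x + t * y) ^ n ≤ s * x ^ n + t * y ^ n := by
  obtain rfl | hn := Nat.eq_zero_or_pos n
  · simp [hst]
  · simpa [ENNReal.rpow_natCast] using
      ENNReal.rpow_arith_mean_le_arith_mean2_rpow s t x y hst (p := n) (by exact_mod_cast hn)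

lemma exists_gt_tsum_mul_pow_lt {ι : Type*} {q : ι → ℝ≥0∞} {e : ι → ℕ} {x y : ℝ≥0} (hxy : x < y)
    {c : ℝ≥0∞} (hx : ∑' i, q i * (x : ℝ≥0∞) ^ e i < c) (hy : ∑' i, q i * (y : ℝ≥0∞) ^ e i ≠ ∞) :
    ∃ z : ℝ≥0, x < z ∧ z ≤ y ∧ ∑' i, q i * (z : ℝ≥0∞) ^ e i < c := by
  obtain ⟨t, ht0, ht⟩ := ENNReal.exists_nnreal_pos_mul_lt hy (tsub_pos_of_lt hx).ne'
  set s := min t 1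
  have : 0 < s := lt_min ht0 one_pos
  have hs1 : (1 - s) + s = 1 := tsub_add_cancel_of_le (min_le_right t 1)
  have hs1' : ((1 - s : ℝ≥0) : ℝ≥0∞) + s = 1 := by rw [← ENNReal.coe_add, hs1, ENNReal.coe_one]
  refine ⟨(1 - s) * x + s * y, ?_, ?_, ?_⟩
  · calc x = (1 - s) * x + s * x := by rw [← add_mul, hs1, one_mul]
      _ < (1 - s) * x + s * y := by gcongr
  · calc (1 - s) * x + s * y ≤ (1 - s) * y + s * y := by gcongr
      _ = y := by rw [← add_mul, hs1, one_mul]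
  · push_cast [-ENNReal.coe_sub]
    calc ∑' i, q i * (((1 - s : ℝ≥0) : ℝ≥0∞) * x + s * y) ^ e i
        ≤ ∑' i, (((1 - s : ℝ≥0) : ℝ≥0∞) * (q i * (x : ℝ≥0∞) ^ e i)
            + s * (q i * (y : ℝ≥0∞) ^ e i)) := by
          refine ENNReal.tsum_le_tsum fun i => ?_
          rw [mul_left_comm _ (q i), mul_left_comm _ (q i), ← mul_add]
          gcongr
          exact pow_arith_mean_le_arith_mean_pow hs1' _ _ _
      _ = ((1 - s : ℝ≥0) : ℝ≥0∞) * ∑' i, q i * (x : ℝ≥0∞) ^ e i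
          + s * ∑' i, q i * (y : ℝ≥0∞) ^ e i := by
          rw [ENNReal.tsum_add, ENNReal.tsum_mul_left, ENNReal.tsum_mul_left]
      _ ≤ ∑' i, q i * (x : ℝ≥0∞) ^ e i + t * ∑' i, q i * (y : ℝ≥0∞) ^ e i := by
          gcongr
          · exact mul_le_of_le_one_left' (by exact_mod_cast tsub_le_self)
          · exact min_le_left t 1
      _ < c := lt_tsub_iff_left.1 ht

end Kernel

section Deletion

variable {V : Type*} {k : V → V → ℝ≥0∞} {v o : V}

open Classical in
/-- The step weights `k` with the vertex `v` removed. Comparing the cycles at another vertex `o`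
for `k` and for `deleteVertex k v` singles out those that pass through `v`. -/
def deleteVertex (k : V → V → ℝ≥0∞) (v i j : V) : ℝ≥0∞ :=
  if i = v ∨ j = v then 0 else k i j

lemma deleteVertex_le (i j : V) : deleteVertex k v i j ≤ k i j := by
  rw [deleteVertex]
  split_ifs
  exacts [zero_le, le_rfl]

lemma deleteVertex_const_mul (z : ℝ≥0∞) :
    deleteVertex (fun i j => z * k i j) v = fun i j => z * deleteVertex k v i j := by
  ext i j
  simp only [deleteVertex, mul_ite, mul_zero]

lemma passageSum_deleteVertex_le (j : V) :
    passageSum (deleteVertex k v) o j ≤ passageSum k o j :=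
  passageSum_mono deleteVertex_le j

lemma passageSum_deleteVertex_self (hvo : v ≠ o) : passageSum (deleteVertex k v) o v = 0 := by
  rw [passageSum_of_ne hvo]
  simp [deleteVertex]

lemma tsum_mul_passageSum_deleteVertex (hvo : v ≠ o) {j : V} (hj : j ≠ v) :
    ∑' l, k j l * passageSum (deleteVertex k v) o l =
      ∑' l, deleteVertex k v j l * passageSum (deleteVertex k v) o l := by
  refine tsum_congr fun l => ?_
  obtain rfl | hl := eq_or_ne l v
  · simp [passageSum_deleteVertex_self hvo]
  · simp [deleteVertex, hj, hl]

lemma returnSum_ne_top_of_deleteVertex (hvo : v ≠ o) (h' : returnSum (deleteVertex k v) o < 1)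
    (h : returnSum k o ≠ ∞) (hov : Relation.ReflTransGen (fun i l => k i l ≠ 0) o v)
    (hvo' : Relation.ReflTransGen (fun i l => k i l ≠ 0) v o) : returnSum k v ≠ ∞ := by
  set f := passageSum (deleteVertex k v) o with hf
  set g := passageSum k o with hg
  have hfv : f v = 0 := passageSum_deleteVertex_self hvo
  have hg0 : g v ≠ 0 := passageSum_ne_zero hvo'
  have hgtop : g v ≠ ∞ := passageSum_ne_top h hov
  obtain ⟨s, hspos, hs⟩ := ENNReal.exists_nnreal_pos_mul_lt h (tsub_pos_of_lt h').ne'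
  have hs0 : (s : ℝ≥0∞) ≠ 0 := by simpa using hspos.ne'
  -- `f` has room to spare at `o`, and this pays for the excess of the term `s * g`, which makes the
  -- sum positive at `v`.
  have hsuper : ∀ j ≠ v, ∑' l, k j l * (f l + s * g l) ≤ f j + s * g j := fun j hj => by
    simp only [mul_add, ENNReal.tsum_add, mul_left_comm _ (s : ℝ≥0∞), ENNReal.tsum_mul_left]
    rw [hf, tsum_mul_passageSum_deleteVertex hvo hj]
    obtain rfl | hjo := eq_or_ne j o
    · rw [passageSum_self]
      exact (lt_tsub_iff_left.1 hs).le.trans le_self_add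
    · rw [passageSum_of_ne hjo, hg, passageSum_of_ne hjo]
  have hbound : (s * g v) * returnSum k v ≤ (1 + (s : ℝ≥0∞)) * g v := by
    calc (s * g v) * returnSum k v ≤ ∑' l, k v l * (f l + s * g l) := by
          simpa [hfv] using mul_returnSum_le hsuper
      _ ≤ ∑' l, (1 + (s : ℝ≥0∞)) * (k v l * g l) := by
          refine ENNReal.tsum_le_tsum fun l => ?_
          rw [mul_left_comm (1 + (s : ℝ≥0∞)), add_mul, one_mul]
          gcongr
          exact passageSum_deleteVertex_le l
      _ = (1 + (s : ℝ≥0∞)) * g v := by rw [ENNReal.tsum_mul_left, hg, passageSum_of_ne hvo]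
  exact ne_top_of_mul_le (mul_ne_zero hs0 hg0) (by finiteness) hbound

lemma eq_of_tsum_mul_eq_tsum_mul {ι : Type*} {a b f g : ι → ℝ≥0∞} (hab : a ≤ b) (hfg : f ≤ g)
    (h : ∑' i, a i * f i = ∑' i, b i * g i) (htop : ∑' i, b i * g i ≠ ∞) {i : ι}
    (h0 : b i ≠ 0) (hi : b i ≠ ∞) : f i = g i := by
  refine (hfg i).antisymm (not_lt.1 fun hlt => ?_)
  refine (ENNReal.tsum_lt_tsum (h ▸ htop) (fun j => mul_le_mul' (hab j) (hfg j)) (i := i) ?_).ne h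
  exact (mul_le_mul_left (hab i) _).trans_lt (ENNReal.mul_lt_mul_right h0 hi hlt)

lemma returnSum_deleteVertex_lt (hvo : v ≠ o) (hk : ∀ i j, k i j ≠ ∞) (h : returnSum k o ≠ ∞)
    (hov : Relation.ReflTransGen (fun i l => k i l ≠ 0) o v)
    (hvo' : Relation.ReflTransGen (fun i l => k i l ≠ 0) v o) :
    returnSum (deleteVertex k v) o < returnSum k o := by
  have hle : returnSum (deleteVertex k v) o ≤ returnSum k o :=
    ENNReal.tsum_le_tsum fun l => mul_le_mul' (deleteVertex_le o l) (passageSum_deleteVertex_le l)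
  refine hle.lt_of_ne fun heq => passageSum_ne_zero hvo' ?_
  -- Equality of the two sums would spread from `o` to all vertices reachable from it.
  suffices ∀ j, Relation.ReflTransGen (fun i l => k i l ≠ 0) o j →
      passageSum (deleteVertex k v) o j = passageSum k o j from
    (this v hov).symm.trans (passageSum_deleteVertex_self hvo)
  intro j hj
  induction hj with
  | refl => rw [passageSum_self, passageSum_self]
  | @tail j l hoj hjl ih =>
    refine eq_of_tsum_mul_eq_tsum_mul (deleteVertex_le (k := k) (v := v) j)
      passageSum_deleteVertex_le ?_ ?_ hjl (hk j l)
    all_goals obtain rfl | hjo := eq_or_ne j o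
    · exact heq
    · rwa [← passageSum_of_ne hjo, ← passageSum_of_ne hjo]
    · exact h
    · rw [← passageSum_of_ne hjo]
      exact passageSum_ne_top h hoj

lemma exists_gt_returnSum_deleteVertex_lt_one (hvo : v ≠ o) (hk : ∀ i j, k i j ≠ ∞)
    (hov : Relation.ReflTransGen (fun i l => k i l ≠ 0) o v)
    (hvo' : Relation.ReflTransGen (fun i l => k i l ≠ 0) v o) {x y : ℝ≥0} (hxy : x < y)
    (hx : returnSum (fun i j => x * k i j) o ≤ 1) (hy : returnSum (fun i j => y * k i j) o ≠ ∞) :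
    ∃ z : ℝ≥0, x < z ∧ z ≤ y ∧ returnSum (deleteVertex (fun i j => z * k i j) v) o < 1 := by
  have hpath : x ≠ 0 → ∀ i l, Relation.ReflTransGen (fun i l => k i l ≠ 0) i l →
      Relation.ReflTransGen (fun i l => (x : ℝ≥0∞) * k i l ≠ 0) i l := fun hx0 =>
    Relation.ReflTransGen.mono fun _ _ => mul_ne_zero (by simpa using hx0)
  have hx' : returnSum (deleteVertex (fun i j => x * k i j) v) o < 1 := by
    obtain rfl | hx0 := eq_or_ne x 0
    · simp [returnSum, deleteVertex]
    · have hkx : ∀ i j, (x : ℝ≥0∞) * k i j ≠ ∞ := fun i j => ENNReal.mul_ne_top (by simp) (hk i j)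
      exact (returnSum_deleteVertex_lt hvo hkx
        (ne_top_of_le_ne_top ENNReal.one_ne_top hx) (hpath hx0 _ _ hov)
        (hpath hx0 _ _ hvo')).trans_le hx
  have hy' : returnSum (deleteVertex (fun i j => y * k i j) v) o ≠ ∞ :=
    ne_top_of_le_ne_top hy <| ENNReal.tsum_le_tsum fun l =>
      mul_le_mul' (deleteVertex_le o l) (passageSum_deleteVertex_le l)
  simp only [deleteVertex_const_mul, returnSum_const_mul] at hx' hy' ⊢
  exact exists_gt_tsum_mul_pow_lt hxy hx' hy'

end Deletion

namespace DiGraph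

section CycleSum

variable {V : Type*} {G H : DiGraph V} {W : V → V → ℝ} {v : V} {n : ℕ}

lemma isSimpleCycle_succ_iff {p : Fin (n + 2) → V} :
    G.IsSimpleCycle v (n + 1) p ↔
      (∀ i : Fin (n + 1), G.Adj (p i.castSucc) (p i.succ)) ∧ p 0 = v ∧
        ∀ i : Fin (n + 1), p i.succ = v ↔ i = Fin.last n := by
  constructor
  · rintro ⟨-, h0, hlast, hadj, hne⟩
    refine ⟨hadj, h0, fun i => ⟨fun hi => ?_, fun hi => by rw [hi, Fin.succ_last, hlast]⟩⟩
    by_contra hil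
    exact hne i.succ i.succ_ne_zero (by rwa [← Fin.succ_last, Ne, Fin.succ_inj]) hi
  · rintro ⟨hadj, h0, h⟩
    refine ⟨by omega, h0, by rw [← Fin.succ_last, h], hadj, fun i hi0 hil hiv => hil ?_⟩
    obtain ⟨i, rfl⟩ := Fin.exists_succ_eq.2 hi0
    rw [(h i).1 hiv, Fin.succ_last]

lemma IsSimpleCycle.mono (h : ∀ u v, H.Adj u v → G.Adj u v) {p : Fin (n + 1) → V}
    (hp : H.IsSimpleCycle v n p) : G.IsSimpleCycle v n p :=
  ⟨hp.1, hp.2.1, hp.2.2.1, fun i => h _ _ (hp.2.2.2.1 i), hp.2.2.2.2⟩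

lemma cycleSum_eq_tsum_indicator :
    G.cycleSum W v n = ∑' p, {p : Fin (n + 1) → V | G.IsSimpleCycle v n p}.indicator
      (fun p => ENNReal.ofReal (pathWeight W p)) p :=
  tsum_subtype {p : Fin (n + 1) → V | G.IsSimpleCycle v n p}
    fun p => ENNReal.ofReal (pathWeight W p)

lemma cycleSum_eq_zero (h : ∀ p, ¬ G.IsSimpleCycle v n p) : G.cycleSum W v n = 0 := by
  have : IsEmpty {p : Fin (n + 1) → V // G.IsSimpleCycle v n p} := ⟨fun p => h _ p.2⟩
  simp [cycleSum]

lemma cycleSum_zero : G.cycleSum W v 0 = 0 :=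
  cycleSum_eq_zero fun _ hp => absurd hp.1 (by omega)

lemma cycleSum_le_cycleSum (h : ∀ p, H.IsSimpleCycle v n p → G.IsSimpleCycle v n p) :
    H.cycleSum W v n ≤ G.cycleSum W v n := by
  simp only [cycleSum_eq_tsum_indicator]
  exact ENNReal.tsum_le_tsum fun p => Set.indicator_le_indicator_of_subset h (fun _ => zero_le) p

lemma pathWeight_pos (hW : ∀ i j, G.Adj i j → 0 < W i j) {p : Fin (n + 1) → V}
    (hp : G.IsSimpleCycle v n p) : 0 < pathWeight W p :=
  Finset.prod_pos fun i _ => hW _ _ (hp.2.2.2.1 i)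

lemma cycleSum_ne_zero (hW : ∀ i j, G.Adj i j → 0 < W i j) {p : Fin (n + 1) → V}
    (hp : G.IsSimpleCycle v n p) : G.cycleSum W v n ≠ 0 := by
  rw [cycleSum, Ne, ENNReal.tsum_eq_zero, not_forall]
  exact ⟨⟨p, hp⟩, by simpa using pathWeight_pos hW hp⟩

lemma cycleSum_ne_top (h : {p | G.IsSimpleCycle v n p}.Finite) : G.cycleSum W v n ≠ ∞ := by
  have : Fintype {p : Fin (n + 1) → V // G.IsSimpleCycle v n p} := h.fintype
  rw [cycleSum, tsum_fintype]
  exact ENNReal.sum_ne_top.2 fun _ _ => ENNReal.ofReal_ne_top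

lemma genFun_zero : G.genFun W v 0 = 0 := by
  refine ENNReal.tsum_eq_zero.2 fun n => ?_
  obtain rfl | hn := eq_or_ne n 0
  · rw [cycleSum_zero, zero_mul]
  · rw [zero_pow hn, mul_zero]

lemma genFun_mono {x y : ℝ≥0∞} (h : x ≤ y) : G.genFun W v x ≤ G.genFun W v y := by
  simp only [genFun]
  gcongr

lemma genFun_eq_top_of_convRadius_lt {z : ℝ≥0} (hz : G.convRadius W v < z) :
    G.genFun W v z = ∞ := by
  by_contra hfin
  exact hz.not_ge (le_iSup₂ (f := fun (r : ℝ≥0) (_ : G.genFun W v r < ∞) => (r : ℝ≥0∞)) z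
    (lt_top_iff_ne_top.2 hfin))

end CycleSum

section Kernel

variable {V : Type*} {G : DiGraph V} {W : V → V → ℝ}

open Classical in
/-- The weights of the edges, extended by zero to all pairs of vertices. They are the step weights
to which `firstPassage` and `returnSum` are applied. -/
def edgeWeight (G : DiGraph V) (W : V → V → ℝ) (i j : V) : ℝ≥0∞ :=
  if G.Adj i j then ENNReal.ofReal (W i j) else 0

lemma edgeWeight_of_adj {i j : V} (h : G.Adj i j) :
    G.edgeWeight W i j = ENNReal.ofReal (W i j) := if_pos h

lemma edgeWeight_of_not_adj {i j : V} (h : ¬ G.Adj i j) : G.edgeWeight W i j = 0 := if_neg h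

lemma edgeWeight_ne_zero (hW : ∀ i j, G.Adj i j → 0 < W i j) {i j : V} (h : G.Adj i j) :
    G.edgeWeight W i j ≠ 0 := by
  simpa [edgeWeight_of_adj h] using hW i j h

lemma prod_edgeWeight_of_adj (hW : ∀ i j, G.Adj i j → 0 < W i j) {n : ℕ} {p : Fin (n + 1) → V}
    (hp : ∀ i : Fin n, G.Adj (p i.castSucc) (p i.succ)) :
    ∏ i : Fin n, G.edgeWeight W (p i.castSucc) (p i.succ) = ENNReal.ofReal (pathWeight W p) := by
  rw [pathWeight, ENNReal.ofReal_prod_of_nonneg fun i _ => (hW _ _ (hp i)).le]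
  exact Finset.prod_congr rfl fun i _ => edgeWeight_of_adj (hp i)

lemma prod_edgeWeight_of_not_adj {n : ℕ} {p : Fin (n + 1) → V}
    (hp : ¬ ∀ i : Fin n, G.Adj (p i.castSucc) (p i.succ)) :
    ∏ i : Fin n, G.edgeWeight W (p i.castSucc) (p i.succ) = 0 := by
  obtain ⟨i, hi⟩ := not_forall.1 hp
  exact Finset.prod_eq_zero (Finset.mem_univ i) (edgeWeight_of_not_adj hi)

lemma tsum_fin_succ {n : ℕ} (f : (Fin (n + 1) → V) → ℝ≥0∞) :
    ∑' p, f p = ∑' j : V, ∑' t : Fin n → V, f (Fin.cons j t) := by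
  rw [← ENNReal.tsum_prod, ← (Fin.consEquiv fun _ : Fin (n + 1) => V).tsum_eq]
  rfl

open Classical in
lemma firstPassage_eq_tsum (k : V → V → ℝ≥0∞) (v : V) (n : ℕ) (j : V) :
    firstPassage k v n j = ∑' t : Fin n → V, let p : Fin (n + 1) → V := Fin.cons j t
      if ∀ i, p i = v ↔ i = Fin.last n then ∏ i : Fin n, k (p i.castSucc) (p i.succ) else 0 := by
  induction n generalizing j with
  | zero =>
    rw [tsum_eq_single default fun b hb => absurd (Subsingleton.elim _ _) hb]
    simp [firstPassage, Fin.forall_fin_one]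
  | succ n ih =>
    have hlast : (0 : Fin (n + 2)) ≠ (Fin.last n).succ := (Fin.succ_ne_zero _).symm
    simp only [Fin.forall_fin_succ (n := n + 1), Fin.cons_zero, Fin.cons_succ, ← Fin.succ_last,
      Fin.succ_inj, hlast, iff_false]
    obtain rfl | hj := eq_or_ne j v
    · simp [firstPassage]
    · simp only [firstPassage, hj, if_false, not_false_eq_true, true_and, ih, tsum_fin_succ,
        ← ENNReal.tsum_mul_left, Fin.prod_univ_succ (n := n), mul_ite, mul_zero]
      rfl

open Classical in
lemma cycleSum_succ (hW : ∀ i j, G.Adj i j → 0 < W i j) (v : V) (n : ℕ) :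
    G.cycleSum W v (n + 1) =
      ∑' l, G.edgeWeight W v l * firstPassage (G.edgeWeight W) v n l := by
  have hterm : ∀ p : Fin (n + 2) → V, {p : Fin (n + 2) → V | G.IsSimpleCycle v (n + 1) p}.indicator
      (fun p => ENNReal.ofReal (pathWeight W p)) p =
      if p 0 = v ∧ ∀ i : Fin (n + 1), p i.succ = v ↔ i = Fin.last n then
        ∏ i : Fin (n + 1), G.edgeWeight W (p i.castSucc) (p i.succ) else 0 := fun p => by
    simp only [Set.indicator_apply, Set.mem_ofPred_eq, isSimpleCycle_succ_iff]
    by_cases hp : ∀ i : Fin (n + 1), G.Adj (p i.castSucc) (p i.succ)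
    · simp only [prod_edgeWeight_of_adj hW hp, hp, implies_true, true_and]
    · simp only [prod_edgeWeight_of_not_adj hp, hp, false_and, if_false, ite_self]
  rw [cycleSum_eq_tsum_indicator, tsum_congr hterm, tsum_fin_succ, tsum_eq_single v]
  · simp only [firstPassage_eq_tsum, tsum_fin_succ, ← ENNReal.tsum_mul_left,
      Fin.prod_univ_succ (n := n), mul_ite, mul_zero, Fin.cons_zero, Fin.cons_succ, true_and]
    rfl
  · intro j hj
    simp [hj]

lemma genFun_eq_returnSum (hW : ∀ i j, G.Adj i j → 0 < W i j) (v : V) (z : ℝ≥0∞) :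
    G.genFun W v z = returnSum (fun i j => z * G.edgeWeight W i j) v := by
  rw [genFun, tsum_eq_zero_add' ENNReal.summable, cycleSum_zero, zero_mul, zero_add,
    returnSum_const_mul]
  simp only [cycleSum_succ hW]

lemma edgeWeight_ne_top (i j : V) : G.edgeWeight W i j ≠ ∞ := by
  rw [edgeWeight]
  split_ifs <;> simp

lemma IsConnected.reflTransGen_edgeWeight (hG : G.IsConnected)
    (hW : ∀ i j, G.Adj i j → 0 < W i j) {z : ℝ≥0∞} (hz : z ≠ 0) {u v : V} (hu : u ∈ G.verts)
    (hv : v ∈ G.verts) : Relation.ReflTransGen (fun i j => z * G.edgeWeight W i j ≠ 0) u v :=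
  Relation.ReflTransGen.mono (fun _ _ h => mul_ne_zero hz (edgeWeight_ne_zero hW h)) _ _
    (hG u hu v hv).to_reflTransGen

lemma IsConnected.genFun_le_one (hG : G.IsConnected) (hW : ∀ i j, G.Adj i j → 0 < W i j)
    {u v : V} (hu : u ∈ G.verts) (hv : v ∈ G.verts) {z : ℝ≥0∞} (h : G.genFun W v z ≤ 1) :
    G.genFun W u z ≤ 1 := by
  obtain rfl | hz := eq_or_ne z 0
  · simp [genFun_zero]
  rw [genFun_eq_returnSum hW] at h ⊢
  exact returnSum_le_one_of_reflTransGen h (hG.reflTransGen_edgeWeight hW hz hu hv)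
    (hG.reflTransGen_edgeWeight hW hz hv hu)

lemma IsConnected.genFun_top (hG : G.IsConnected) (hW : ∀ i j, G.Adj i j → 0 < W i j) {v : V}
    (hv : v ∈ G.verts) : G.genFun W v ∞ = ∞ := by
  obtain ⟨l, hvl, -⟩ := Relation.TransGen.head'_iff.1 (hG v hv v hv)
  rw [genFun_eq_returnSum hW, ← top_le_iff]
  refine le_trans ?_ (ENNReal.le_tsum l)
  beta_reduce
  rw [ENNReal.top_mul (edgeWeight_ne_zero hW hvl), ENNReal.top_mul]
  exact passageSum_ne_zero
    (hG.reflTransGen_edgeWeight hW ENNReal.top_ne_zero (G.snd_mem hvl) hv)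

lemma IsConnected.genFun_eq_top (hG : G.IsConnected) (hW : ∀ i j, G.Adj i j → 0 < W i j)
    {u v : V} (hu : u ∈ G.verts) (hv : v ∈ G.verts) {R : ℝ≥0} (hR : G.genFun W u R ≤ 1)
    (hdiv : ∀ z : ℝ≥0, R < z → G.genFun W v z = ∞) {z : ℝ≥0} (hz : R < z) :
    G.genFun W u z = ∞ := by
  obtain rfl | hvu := eq_or_ne v u
  · exact hdiv z hz
  by_contra hfin
  rw [genFun_eq_returnSum hW] at hR hfin
  have hpath {i j : V} (hi : i ∈ G.verts) (hj : j ∈ G.verts) :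
      Relation.ReflTransGen (fun i j => G.edgeWeight W i j ≠ 0) i j := by
    simpa using hG.reflTransGen_edgeWeight hW one_ne_zero hi hj
  obtain ⟨y, hRy, hyz, hy⟩ := exists_gt_returnSum_deleteVertex_lt_one hvu
    (fun i j => edgeWeight_ne_top i j) (hpath hu hv) (hpath hv hu) hz hR hfin
  have hy0 : (y : ℝ≥0∞) ≠ 0 := by simpa using (zero_le.trans_lt hRy).ne'
  have hyfin : returnSum (fun i j => y * G.edgeWeight W i j) u ≠ ∞ := by
    rw [← genFun_eq_returnSum hW] at hfin ⊢
    exact ne_top_of_le_ne_top hfin (genFun_mono (by exact_mod_cast hyz))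
  refine returnSum_ne_top_of_deleteVertex hvu hy hyfin (hG.reflTransGen_edgeWeight hW hy0 hu hv)
    (hG.reflTransGen_edgeWeight hW hy0 hv hu) ?_
  rw [← genFun_eq_returnSum hW, hdiv y hRy]

lemma IsConnected.exists_critical_point (hG : G.IsConnected) (hW : ∀ i j, G.Adj i j → 0 < W i j)
    {u v : V} (hu : u ∈ G.verts) (hv : v ∈ G.verts)
    (h : G.genFun W v (G.convRadius W v) ≤ 1) :
    ∃ R : ℝ≥0, G.genFun W u R ≤ 1 ∧ ∀ z : ℝ≥0, R < z → G.genFun W u z = ∞ := by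
  have htop : G.convRadius W v ≠ ∞ := fun h0 => by
    rw [h0, hG.genFun_top hW hv] at h
    exact absurd h (by simp)
  lift G.convRadius W v to ℝ≥0 using htop with R hR
  have hle : G.genFun W u R ≤ 1 := hG.genFun_le_one hW hu hv h
  refine ⟨R, hle, fun z => hG.genFun_eq_top hW hu hv hle fun z hz => ?_⟩
  exact genFun_eq_top_of_convRadius_lt (by rw [← hR]; exact_mod_cast hz)

end Kernel

section CycleSubgraph

variable {V : Type*} {G : DiGraph V} {W : V → V → ℝ} {v : V} {n m l : ℕ}

lemma adj_of_cycleSubgraph {i j : V} (h : (G.cycleSubgraph v n m).Adj i j) : G.Adj i j := by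
  obtain ⟨γ, hγ, i, rfl, rfl⟩ := h
  exact hγ.1.2.2.2.1 i

lemma IsSimpleCycle.cycleSubgraph {p : Fin (l + 1) → V} (hp : G.IsSimpleCycle v l p)
    (hl : l ≤ n ∨ l = m) : (G.cycleSubgraph v n m).IsSimpleCycle v l p :=
  ⟨hp.1, hp.2.1, hp.2.2.1, fun i => ⟨⟨l, p⟩, ⟨hp, hl⟩, i, rfl, rfl⟩, hp.2.2.2.2⟩

lemma isSubgraph_cycleSubgraph {n' m' : ℕ} (hn : n ≤ n') (hm : m ≤ n') :
    (G.cycleSubgraph v n m).IsSubgraph (G.cycleSubgraph v n' m') := by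
  constructor
  · rintro u ⟨γ, ⟨hγ, hl⟩, hu⟩
    exact ⟨γ, ⟨hγ, by omega⟩, hu⟩
  · rintro i j ⟨γ, ⟨hγ, hl⟩, hij⟩
    exact ⟨γ, ⟨hγ, by omega⟩, hij⟩

lemma cycleSum_cycleSubgraph_le : (G.cycleSubgraph v n m).cycleSum W v l ≤ G.cycleSum W v l :=
  cycleSum_le_cycleSum fun _ hp => hp.mono fun _ _ => adj_of_cycleSubgraph

lemma cycleSum_cycleSubgraph (hl : l ≤ n ∨ l = m) :
    (G.cycleSubgraph v n m).cycleSum W v l = G.cycleSum W v l :=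
  cycleSum_cycleSubgraph_le.antisymm (cycleSum_le_cycleSum fun _ hp => hp.cycleSubgraph hl)

lemma transGen_of_lt {p : Fin (l + 1) → V} (hp : ∀ i : Fin l, G.Adj (p i.castSucc) (p i.succ))
    {i j : Fin (l + 1)} (hij : i < j) : Relation.TransGen G.Adj (p i) (p j) := by
  induction j using Fin.induction with
  | zero => exact absurd hij (Fin.not_lt_zero i)
  | succ j ih =>
    obtain rfl | hlt := (Fin.le_castSucc_iff.2 hij).eq_or_lt
    · exact .single (hp j)
    · exact (ih hlt).tail (hp j)

lemma IsSimpleCycle.transGen {p : Fin (l + 1) → V} (hp : G.IsSimpleCycle v l p)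
    (i : Fin (l + 1)) : Relation.TransGen G.Adj v (p i) ∧ Relation.TransGen G.Adj (p i) v := by
  obtain ⟨hl, h0, hlast, hadj, -⟩ := hp
  have hloop := transGen_of_lt hadj (i := 0) (j := Fin.last l) (Fin.lt_def.2 hl)
  rw [h0, hlast] at hloop
  constructor
  · obtain rfl | hi := (Fin.zero_le i).eq_or_lt
    · rwa [h0]
    · simpa [h0] using transGen_of_lt hadj hi
  · obtain rfl | hi := (Fin.le_last i).eq_or_lt
    · rwa [hlast]
    · simpa [hlast] using transGen_of_lt hadj hi

lemma isConnected_cycleSubgraph : (G.cycleSubgraph v n m).IsConnected := by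
  rintro _ ⟨⟨l, p⟩, ⟨hp, hl⟩, i, rfl⟩ _ ⟨⟨l', p'⟩, ⟨hp', hl'⟩, i', rfl⟩
  exact ((hp.cycleSubgraph hl).transGen i).2.trans ((hp'.cycleSubgraph hl').transGen i').1

end CycleSubgraph

end DiGraph

open DiGraph

section PowerSeries

variable {q : ℕ → ℝ≥0∞}

lemma exists_tsum_mul_pow_eq_one (hq : ∀ l, q l ≠ ∞) (h0 : q 0 = 0) {s : Finset ℕ}
    (hs : ∀ l ∉ s, q l = 0) {m : ℕ} (hm : q m ≠ 0) :
    ∃ r : ℝ≥0, ∑' l, q l * (r : ℝ≥0∞) ^ l = 1 := by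
  have hcont : Continuous fun z : ℝ≥0 => ∑' l, q l * (z : ℝ≥0∞) ^ l := by
    have hsum (z : ℝ≥0) : ∑' l, q l * (z : ℝ≥0∞) ^ l = ∑ l ∈ s, q l * (z : ℝ≥0∞) ^ l :=
      tsum_eq_sum fun l hl => by rw [hs l hl, zero_mul]
    simp only [hsum]
    exact continuous_finsetSum s fun l _ => (ENNReal.continuous_const_mul (hq l)).comp
      ((ENNReal.continuous_pow l).comp ENNReal.continuous_coe)
  obtain ⟨c, hc⟩ : ∃ c : ℝ≥0, (c : ℝ≥0∞) = q m := ⟨_, ENNReal.coe_toNNReal (hq m)⟩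
  have hm0 : m ≠ 0 := fun h => hm (h ▸ h0)
  refine mem_range_of_exists_le_of_exists_ge hcont ⟨0, ?_⟩ ⟨max 1 c⁻¹, ?_⟩
  · refine (ENNReal.tsum_eq_zero.2 fun l => ?_).trans_le zero_le_one
    obtain rfl | hl := eq_or_ne l 0 <;> simp [*]
  · refine le_trans ?_ (ENNReal.le_tsum m)
    have hc0 : c ≠ 0 := by simpa [← hc] using hm
    have hpow : c⁻¹ ≤ max 1 c⁻¹ ^ m :=
      (le_max_right _ _).trans (le_self_pow (le_max_left _ _) hm0)
    calc (1 : ℝ≥0∞) = (c * c⁻¹ : ℝ≥0) := by rw [mul_inv_cancel₀ hc0, ENNReal.coe_one]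
      _ ≤ (c * max 1 c⁻¹ ^ m : ℝ≥0) := by gcongr
      _ = q m * ((max 1 c⁻¹ : ℝ≥0) : ℝ≥0∞) ^ m := by rw [← hc, ENNReal.coe_mul, ENNReal.coe_pow]

lemma exists_one_le_mul_pow (hq : ∀ l, q l ≠ ∞) {σ ρ : ℝ≥0} (hσρ : σ < ρ)
    (hdiv : ∑' l, q l * (σ : ℝ≥0∞) ^ l = ∞) (M : ℕ) :
    ∃ m ≥ M, 1 ≤ q m * (ρ : ℝ≥0∞) ^ m := by
  by_contra! hlt
  have hρ : (ρ : ℝ≥0∞) ≠ 0 := by simpa using (zero_le.trans_lt hσρ).ne'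
  have hratio : (σ : ℝ≥0∞) / ρ < 1 := by
    rw [ENNReal.div_lt_iff (Or.inl hρ) (Or.inl (by simp)), one_mul]
    exact_mod_cast hσρ
  have htail : ∑' l, q (l + M) * (σ : ℝ≥0∞) ^ (l + M) ≤ ∑' l, ((σ : ℝ≥0∞) / ρ) ^ l := by
    refine ENNReal.tsum_le_tsum fun l => ?_
    calc q (l + M) * (σ : ℝ≥0∞) ^ (l + M)
        = q (l + M) * (ρ : ℝ≥0∞) ^ (l + M) * ((σ : ℝ≥0∞) / ρ) ^ (l + M) := by
          rw [mul_assoc, ← mul_pow, ENNReal.mul_div_cancel hρ (by simp)]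
      _ ≤ 1 * ((σ : ℝ≥0∞) / ρ) ^ (l + M) := by
          gcongr
          exact (hlt (l + M) (by omega)).le
      _ ≤ ((σ : ℝ≥0∞) / ρ) ^ l := by
          rw [one_mul]
          exact pow_le_pow_right_of_le_one' hratio.le (by omega)
  rw [ENNReal.tsum_geometric] at htail
  refine ENNReal.add_ne_top.2 ⟨ENNReal.sum_ne_top.2 fun l (_ : l ∈ Finset.range M) => ?_,
    ne_top_of_le_ne_top (ENNReal.inv_ne_top.2 (tsub_pos_of_lt hratio).ne') htail⟩
    ((ENNReal.summable.sum_add_tsum_nat_add' (f := fun l => q l * (σ : ℝ≥0∞) ^ l)).trans hdiv)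
  exact ENNReal.mul_ne_top (hq l) (by finiteness)

lemma sum_range_mul_pow_lt_one (hq : ∀ l, q l ≠ ∞) (h0 : q 0 = 0) {N : ℕ} (hN : q N ≠ 0)
    {R : ℝ≥0} (hR : ∑' l, q l * (R : ℝ≥0∞) ^ l ≤ 1) :
    ∑ l ∈ Finset.range N, q l * (R : ℝ≥0∞) ^ l < 1 := by
  obtain rfl | hR0 := eq_or_ne R 0
  · refine (Finset.sum_eq_zero fun l _ => ?_).trans_lt one_pos
    obtain rfl | hl := eq_or_ne l 0 <;> simp [*]
  calc ∑ l ∈ Finset.range N, q l * (R : ℝ≥0∞) ^ l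
      < ∑ l ∈ Finset.range N, q l * (R : ℝ≥0∞) ^ l + q N * (R : ℝ≥0∞) ^ N :=
        ENNReal.lt_add_right
          (ENNReal.sum_ne_top.2 fun l _ => ENNReal.mul_ne_top (hq l) (by finiteness))
          (mul_ne_zero hN (pow_ne_zero N (by simpa using hR0)))
    _ = ∑ l ∈ Finset.range (N + 1), q l * (R : ℝ≥0∞) ^ l := (Finset.sum_range_succ _ N).symm
    _ ≤ 1 := (ENNReal.sum_le_tsum _).trans hR

lemma exists_gt_sum_range_mul_pow_lt (hq : ∀ l, q l ≠ ∞) {N : ℕ} {x : ℝ≥0} {c : ℝ≥0∞}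
    (hx : ∑ l ∈ Finset.range N, q l * (x : ℝ≥0∞) ^ l < c) :
    ∃ y > x, ∑ l ∈ Finset.range N, q l * (y : ℝ≥0∞) ^ l < c := by
  simp only [Finset.sum_range, ← tsum_fintype (L := .unconditional _)] at hx ⊢
  obtain ⟨y, hxy, -, hy⟩ := exists_gt_tsum_mul_pow_lt (lt_add_one x) hx <| by
    rw [tsum_fintype]
    exact ENNReal.sum_ne_top.2 fun l _ => ENNReal.mul_ne_top (hq l) (by finiteness)
  exact ⟨y, hxy, hy⟩

end PowerSeries

/-- The vertices of the simple `1`-cycles at time `i` are bounded by `B i`. -/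
def IsReachBound (G : DiGraph ℕ) (B : ℕ → ℕ) : Prop :=
  Monotone B ∧ ∀ (n : ℕ) (p : Fin (n + 1) → ℕ), G.IsSimpleCycle 1 n p → ∀ i, p i ≤ B i

namespace IsLinear

variable {G : DiGraph ℕ} {W : ℕ → ℕ → ℝ} {B : ℕ → ℕ} {n m l : ℕ}

lemma one_le (hG : IsLinear G) {i j : ℕ} (h : G.Adj i j) : 1 ≤ i := by
  simpa [hG.verts_eq] using G.fst_mem h

lemma lt_of_adj (hG : IsLinear G) {i j : ℕ} (h : G.Adj i j) (hj : j ≠ 1) : i < j := by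
  have := hG.adj_cases i j h
  omega

lemma index_lt (hG : IsLinear G) {p : Fin (n + 1) → ℕ} (hp : G.IsSimpleCycle 1 n p) (i : Fin n) :
    i < p i.castSucc := by
  obtain ⟨i, hi⟩ := i
  induction i with
  | zero => exact hp.2.1 ▸ zero_lt_one
  | succ i ih =>
    have hne : p (Fin.succ ⟨i, by omega⟩) ≠ 1 :=
      hp.2.2.2.2 _ (Fin.succ_ne_zero _) (by simp [Fin.ext_iff]; omega)
    exact (Nat.succ_le_of_lt (ih (by omega))).trans_lt (hG.lt_of_adj (hp.2.2.2.1 ⟨i, _⟩) hne)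

lemma bddAbove_adj (hG : IsLinear G) (b : ℕ) : BddAbove {j | ∃ i ≤ b, G.Adj i j} := by
  have hfin : (⋃ i ∈ Set.Iic b, {j | i + 1 < j ∧ G.Adj i j}).Finite :=
    (Set.finite_Iic b).biUnion fun i _ => hG.finite_jumps i
  refine (hfin.bddAbove.union (bddAbove_Iic (a := b + 1))).mono ?_
  rintro j ⟨i, hi, hij⟩
  obtain h | h | h := hG.adj_cases i j hij
  · exact Or.inr (by simp [h])
  · exact Or.inr (by simp [h, hi])
  · exact Or.inl (Set.mem_biUnion (Set.mem_Iic.2 hi) ⟨h, hij⟩)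

lemma exists_isReachBound (hG : IsLinear G) : ∃ B, IsReachBound G B := by
  choose f hf using hG.bddAbove_adj
  set g : ℕ → ℕ := fun b => max b (f b)
  refine ⟨fun n => g^[n] 1, monotone_nat_of_le_succ fun n => ?_, fun n p hp => ?_⟩
  · rw [Function.iterate_succ_apply']
    exact le_max_left _ _
  · refine Fin.induction hp.2.1.le fun i ih => ?_
    beta_reduce
    rw [Fin.val_succ, Function.iterate_succ_apply']
    exact le_max_of_le_right (hf _ ⟨_, ih, hp.2.2.2.1 i⟩)

lemma finite_isSimpleCycle (hB : IsReachBound G B) (n : ℕ) :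
    {p | G.IsSimpleCycle 1 n p}.Finite :=
  (Set.Finite.pi' fun i : Fin (n + 1) => Set.finite_Iic (B i)).subset fun p hp => hB.2 n p hp

lemma finite_cycleSubgraph (hB : IsReachBound G B) : (G.cycleSubgraph 1 n m).verts.Finite := by
  refine (Set.finite_Iic (B (max n m))).subset ?_
  rintro u ⟨⟨l, p⟩, ⟨hp, hl⟩, i, rfl⟩
  have hl' : l ≤ max n m := hl.elim le_max_of_le_left fun h => h ▸ le_max_right n m
  exact (hB.2 l p hp i).trans (hB.1 (i.is_le.trans hl'))

lemma isSimpleCycle_straight (hG : IsLinear G) (hn : 1 ≤ n) :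
    G.IsSimpleCycle 1 n (fun i => if (i : ℕ) < n then i + 1 else 1) := by
  refine ⟨hn, by simp, by simp, fun i => ?_, fun i h0 hl => ?_⟩
  · simp only [Fin.val_castSucc, Fin.val_succ, i.2, if_true]
    split_ifs
    exacts [hG.adj_succ _ (by omega), hG.adj_one _ (by omega)]
  · rw [Ne, Fin.ext_iff] at h0 hl
    rw [Fin.val_zero] at h0
    rw [Fin.val_last] at hl
    dsimp only
    split_ifs <;> omega

lemma isSimpleCycle_through (hG : IsLinear G) {j : ℕ} (hn : 1 ≤ n) (hnj : G.Adj n j)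
    (hj : j ≠ 1) : G.IsSimpleCycle 1 (n + 1)
      (fun i => if (i : ℕ) < n then i + 1 else if (i : ℕ) = n then j else 1) := by
  have hlt := hG.lt_of_adj hnj hj
  refine ⟨by omega, by simp; omega, by simp, fun i => ?_, fun i h0 hl => ?_⟩
  · simp only [Fin.val_castSucc, Fin.val_succ]
    split_ifs with h1 h2 h3 <;> try omega
    · exact hG.adj_succ _ (by omega)
    · rwa [show (i : ℕ) + 1 = n by omega]
    · exact hG.adj_one _ (by omega)
  · rw [Ne, Fin.ext_iff] at h0 hl
    rw [Fin.val_zero] at h0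
    rw [Fin.val_last] at hl
    dsimp only
    split_ifs <;> omega

lemma exists_isSimpleCycle_adj (hG : IsLinear G) {u v : ℕ} (h : G.Adj u v) :
    ∃ n, ∃ p : Fin (n + 1) → ℕ, G.IsSimpleCycle 1 n p ∧
      ∃ i : Fin n, p i.castSucc = u ∧ p i.succ = v := by
  have hu := hG.one_le h
  obtain rfl | hv := eq_or_ne v 1
  · refine ⟨u, _, hG.isSimpleCycle_straight hu, ⟨u - 1, by omega⟩, ?_, ?_⟩ <;>
    · simp only [Fin.val_castSucc, Fin.val_succ]
      split_ifs <;> omega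
  · refine ⟨u + 1, _, hG.isSimpleCycle_through hu h hv, ⟨u - 1, by omega⟩, ?_, ?_⟩ <;>
    · simp only [Fin.val_castSucc, Fin.val_succ]
      split_ifs <;> omega

lemma isConnected (hG : IsLinear G) : G.IsConnected := by
  have hto (u : ℕ) (hu : u ∈ G.verts) : Relation.TransGen G.Adj u 1 :=
    .single (hG.adj_one u (by simpa [hG.verts_eq] using hu))
  have hfrom (v : ℕ) (hv : v ∈ G.verts) : Relation.TransGen G.Adj 1 v := by
    obtain ⟨n, p, hp, i, rfl, -⟩ :=
      hG.exists_isSimpleCycle_adj (hG.adj_one v (by simpa [hG.verts_eq] using hv))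
    exact (hp.transGen _).1
  exact fun u hu v hv => (hto u hu).trans (hfrom v hv)

lemma isExhaustive_cycleSubgraph (hG : IsLinear G) {n : ℕ → ℕ} (hn : StrictMono n) :
    G.IsExhaustive (fun k => G.cycleSubgraph 1 (n k) (n (k + 1))) := by
  have hadj (u v : ℕ) (h : G.Adj u v) : ∃ k, (G.cycleSubgraph 1 (n k) (n (k + 1))).Adj u v := by
    obtain ⟨l, p, hp, i, rfl, rfl⟩ := hG.exists_isSimpleCycle_adj h
    exact ⟨l, (hp.cycleSubgraph (Or.inl (hn.id_le l))).2.2.2.1 i⟩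
  refine ⟨fun k => isSubgraph_cycleSubgraph (hn.monotone k.le_succ) le_rfl, ?_,
    fun u v => ⟨fun ⟨_, h⟩ => adj_of_cycleSubgraph h, hadj u v⟩⟩
  refine Set.Subset.antisymm (Set.iUnion_subset fun k u hu => ?_) fun u hu => ?_
  · obtain ⟨w, huw, -⟩ := Relation.TransGen.head'_iff.1 (isConnected_cycleSubgraph u hu u hu)
    exact G.fst_mem (adj_of_cycleSubgraph huw)
  · obtain ⟨k, hk⟩ := hadj u 1 (hG.adj_one u (by simpa [hG.verts_eq] using hu))
    exact Set.mem_iUnion.2 ⟨k, DiGraph.fst_mem _ hk⟩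

-- The last edge `(u, 1)` of a cycle in `G_{n,m}` is also the last edge of one of the cycles that
-- generate it. As a path from `1` reaches `u` neither very soon nor very late, the lengths of the
-- two cycles are comparable.
lemma cycleSum_cycleSubgraph_eq_zero (hG : IsLinear G) (hB : IsReachBound G B) {L : ℕ}
    (hm : B L < m) (hl : B n < l) (hlL : l < L) : (G.cycleSubgraph 1 n m).cycleSum W 1 l = 0 := by
  refine cycleSum_eq_zero fun p hp => ?_
  have hpG := hp.mono fun _ _ => adj_of_cycleSubgraph
  obtain ⟨l, rfl⟩ := Nat.exists_eq_add_of_le' hp.1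
  obtain ⟨⟨l', γ⟩, ⟨hγ, hl'⟩, i, hi, hi'⟩ := hp.2.2.2.1 (Fin.last l)
  obtain ⟨l', rfl⟩ := Nat.exists_eq_add_of_le' hγ.1
  obtain rfl : i = Fin.last l' := by
    rwa [Fin.succ_last, hp.2.2.1, (isSimpleCycle_succ_iff.1 hγ).2.2] at hi'
  have hp_gt := hG.index_lt hpG (Fin.last l)
  have hγ_gt := hG.index_lt hγ (Fin.last l')
  have hp_le := (hB.2 _ p hpG (Fin.last l).castSucc).trans (hB.1 (by simp; omega : _ ≤ L))
  have hγ_le := hB.2 _ γ hγ (Fin.last l').castSucc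
  rw [← hi] at hp_gt hp_le
  obtain hl' | rfl := hl'
  · have := hγ_le.trans (hB.1 (l'.le_succ.trans hl'))
    simp only [Fin.val_last] at *
    omega
  · simp only [Fin.val_last] at *
    omega

lemma cycleSum_one_ne_zero (hG : IsLinear G) (hW : ∀ i j, G.Adj i j → 0 < W i j) (hn : 1 ≤ n) :
    G.cycleSum W 1 n ≠ 0 :=
  cycleSum_ne_zero hW (hG.isSimpleCycle_straight hn)

lemma exists_genFun_cycleSubgraph_eq_one (hG : IsLinear G)
    (hW : ∀ i j, G.Adj i j → 0 < W i j) (hn : 1 ≤ n) (m : ℕ) :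
    ∃ r : ℝ≥0, (G.cycleSubgraph 1 n m).genFun W 1 r = 1 := by
  obtain ⟨B, hB⟩ := hG.exists_isReachBound
  obtain ⟨N, hN⟩ := (finite_cycleSubgraph hB (n := n) (m := m)).bddAbove
  have hlen : ∀ l ∉ Finset.range (N + 1), (G.cycleSubgraph 1 n m).cycleSum W 1 l = 0 := by
    refine fun l hl => cycleSum_eq_zero fun p hp => hl ?_
    obtain ⟨l, rfl⟩ := Nat.exists_eq_add_of_le' hp.1
    have hgt := hG.index_lt (hp.mono fun _ _ => adj_of_cycleSubgraph) (Fin.last l)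
    have hle := hN (DiGraph.fst_mem _ (hp.2.2.2.1 (Fin.last l)))
    simpa using hgt.trans_le hle
  refine exists_tsum_mul_pow_eq_one (m := 1) (fun l => ?_) cycleSum_zero hlen ?_
  · exact ne_top_of_le_ne_top (cycleSum_ne_top (finite_isSimpleCycle hB l))
      cycleSum_cycleSubgraph_le
  · rw [cycleSum_cycleSubgraph (Or.inl hn)]
    exact hG.cycleSum_one_ne_zero hW le_rfl

lemma le_of_genFun_cycleSubgraph_le_one (hqm : G.cycleSum W 1 m ≠ ∞) {r ρ : ℝ≥0}
    (hr : (G.cycleSubgraph 1 n m).genFun W 1 r ≤ 1)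
    (hρ : 1 ≤ G.cycleSum W 1 m * (ρ : ℝ≥0∞) ^ m) : r ≤ ρ := by
  have hm : m ≠ 0 := by
    rintro rfl
    simp [cycleSum_zero] at hρ
  have hqm0 : G.cycleSum W 1 m ≠ 0 := fun h => by simp [h] at hρ
  refine le_of_not_gt fun hlt => (hρ.trans_lt ?_).not_ge hr
  calc G.cycleSum W 1 m * (ρ : ℝ≥0∞) ^ m < G.cycleSum W 1 m * (r : ℝ≥0∞) ^ m :=
        ENNReal.mul_lt_mul_right hqm0 hqm (ENNReal.pow_lt_pow_left hm (by exact_mod_cast hlt))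
    _ = (G.cycleSubgraph 1 n m).cycleSum W 1 m * (r : ℝ≥0∞) ^ m := by
        rw [cycleSum_cycleSubgraph (Or.inr rfl)]
    _ ≤ _ := ENNReal.le_tsum m

lemma sum_range_cycleSum_cycleSubgraph_le (hG : IsLinear G) (hB : IsReachBound G B) {L : ℕ}
    (hm : B L < m) {r ρ : ℝ≥0} (hr : r ≤ ρ) :
    ∑ l ∈ Finset.range L, (G.cycleSubgraph 1 n m).cycleSum W 1 l * (r : ℝ≥0∞) ^ l ≤
      ∑ l ∈ Finset.range (B n + 1), G.cycleSum W 1 l * (ρ : ℝ≥0∞) ^ l := by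
  calc ∑ l ∈ Finset.range L, (G.cycleSubgraph 1 n m).cycleSum W 1 l * (r : ℝ≥0∞) ^ l
      ≤ ∑ l ∈ Finset.range (B n + 1),
          (G.cycleSubgraph 1 n m).cycleSum W 1 l * (r : ℝ≥0∞) ^ l := by
        refine Finset.sum_le_sum_of_ne_zero fun l hl hne => ?_
        rw [Finset.mem_range] at hl ⊢
        refine lt_of_not_ge fun hlt => hne ?_
        rw [hG.cycleSum_cycleSubgraph_eq_zero hB hm (by omega) hl, zero_mul]
    _ ≤ _ := by
        gcongr
        exact cycleSum_cycleSubgraph_le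

/-- The last expression is a lower bound for `∑ l, l * q(l) * r ^ l`, the mean return time to the
vertex `1` under the equilibrium measure of `G_{n,m}`. -/
lemma exists_long_cycles (hG : IsLinear G) (hW : ∀ i j, G.Adj i j → 0 < W i j) {R : ℝ≥0}
    (hR : G.genFun W 1 R ≤ 1) (hdiv : ∀ z : ℝ≥0, R < z → G.genFun W 1 z = ∞) (hn : 1 ≤ n)
    (K : ℝ≥0) :
    ∃ m > n, ∃ r : ℝ≥0, (G.cycleSubgraph 1 n m).genFun W 1 r = 1 ∧ ∃ L : ℕ, (K : ℝ≥0∞) ≤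
      L * ∑' l, (G.cycleSubgraph 1 n m).cycleSum W 1 (l + L) * (r : ℝ≥0∞) ^ (l + L) := by
  obtain ⟨B, hB⟩ := hG.exists_isReachBound
  have hq (l : ℕ) : G.cycleSum W 1 l ≠ ∞ := cycleSum_ne_top (finite_isSimpleCycle hB l)
  obtain ⟨a, haR, ha1⟩ := exists_between <|
    sum_range_mul_pow_lt_one hq cycleSum_zero (hG.cycleSum_one_ne_zero hW (Nat.succ_pos (B n))) hR
  obtain ⟨ρ, hRρ, hρa⟩ := exists_gt_sum_range_mul_pow_lt hq haR
  have ha0 : 1 - a ≠ 0 := (tsub_pos_of_lt ha1).ne'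
  obtain ⟨L, hL⟩ := ENNReal.exists_nat_gt (ENNReal.div_ne_top (ENNReal.coe_ne_top (r := K)) ha0)
  obtain ⟨σ, hRσ, hσρ⟩ := exists_between hRρ
  obtain ⟨m, hmM, hm⟩ := exists_one_le_mul_pow hq hσρ (hdiv σ hRσ) (max (n + 1) (B L + 1))
  obtain ⟨r, hr⟩ := hG.exists_genFun_cycleSubgraph_eq_one hW hn m
  have hrρ : r ≤ ρ := le_of_genFun_cycleSubgraph_le_one (hq m) hr.le hm
  refine ⟨m, by omega, r, hr, L, ?_⟩
  have hlong : 1 - a ≤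
      ∑' l, (G.cycleSubgraph 1 n m).cycleSum W 1 (l + L) * (r : ℝ≥0∞) ^ (l + L) := by
    rw [tsub_le_iff_left, ← hr, genFun, ← ENNReal.summable.sum_add_tsum_nat_add' (k := L)]
    gcongr
    exact (hG.sum_range_cycleSum_cycleSubgraph_le hB (by omega) hrρ).trans hρa.le
  calc (K : ℝ≥0∞) = K / (1 - a) * (1 - a) := (ENNReal.div_mul_cancel ha0 (by finiteness)).symm
    _ ≤ _ := by gcongr

end IsLinear

section Gibbs

open InformationTheory

lemma mul_log_sub_log {a b : ℝ} (hab : b = 0 → a = 0) :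
    a * (Real.log a - Real.log b) = a - b + b * klFun (a / b) := by
  obtain rfl | ha := eq_or_ne a 0
  · simp [klFun_zero]
  · have hb : b ≠ 0 := mt hab ha
    rw [klFun_apply, Real.log_div ha hb]
    field_simp
    ring

variable {ι : Type*} [Fintype ι] {a b : ι → ℝ}

lemma sum_mul_klFun_le_sum_mul_log_sub_log (hab : ∀ i, b i = 0 → a i = 0)
    (hsum : ∑ i, b i ≤ ∑ i, a i) :
    ∑ i, b i * klFun (a i / b i) ≤ ∑ i, a i * (Real.log (a i) - Real.log (b i)) := by
  simp only [mul_log_sub_log (hab _), Finset.sum_add_distrib, Finset.sum_sub_distrib]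
  linarith

lemma sum_mul_log_sub_log_nonneg (ha : ∀ i, 0 ≤ a i) (hb : ∀ i, 0 ≤ b i)
    (hab : ∀ i, b i = 0 → a i = 0) (hsum : ∑ i, b i ≤ ∑ i, a i) :
    0 ≤ ∑ i, a i * (Real.log (a i) - Real.log (b i)) :=
  (Finset.sum_nonneg fun i _ => mul_nonneg (hb i) (klFun_nonneg (div_nonneg (ha i) (hb i)))).trans
    (sum_mul_klFun_le_sum_mul_log_sub_log hab hsum)

lemma eq_of_sum_mul_log_sub_log_nonpos (ha : ∀ i, 0 ≤ a i) (hb : ∀ i, 0 ≤ b i)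
    (hab : ∀ i, b i = 0 → a i = 0) (hsum : ∑ i, b i ≤ ∑ i, a i)
    (h : ∑ i, a i * (Real.log (a i) - Real.log (b i)) ≤ 0) : a = b := by
  have hnonneg (i : ι) : 0 ≤ b i * klFun (a i / b i) :=
    mul_nonneg (hb i) (klFun_nonneg (div_nonneg (ha i) (hb i)))
  have hzero := (Finset.sum_eq_zero_iff_of_nonneg fun i _ => hnonneg i).1
    (((sum_mul_klFun_le_sum_mul_log_sub_log hab hsum).trans h).antisymm
      (Finset.sum_nonneg fun i _ => hnonneg i))
  funext i
  obtain hbi | hkl := mul_eq_zero.1 (hzero i (Finset.mem_univ i))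
  · rw [hbi, hab i hbi]
  · exact eq_of_div_eq_one ((klFun_eq_zero_iff (div_nonneg (ha i) (hb i))).1 hkl)

end Gibbs

section BlockLaw

variable {α : Type*} [Fintype α]

lemma sum_fin_snoc {n : ℕ} (f : (Fin (n + 1) → α) → ℝ) :
    ∑ w, f w = ∑ w : Fin n → α, ∑ a, f (Fin.snoc w a : Fin (n + 1) → α) := by
  rw [← Fintype.sum_prod_type_right', ← (Fin.snocEquiv fun _ : Fin (n + 1) => α).sum_comp]
  rfl

lemma sum_fin_cons {n : ℕ} (f : (Fin (n + 1) → α) → ℝ) :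
    ∑ w, f w = ∑ w : Fin n → α, ∑ a, f (Fin.cons a w : Fin (n + 1) → α) := by
  rw [← Fintype.sum_prod_type_right', ← (Fin.consEquiv fun _ : Fin (n + 1) => α).sum_comp]
  rfl

/-- The finite-dimensional distributions of a stationary process with values in `α`: `p n w` is the
probability of the word `w` of length `n`. -/
structure IsBlockLaw (p : ∀ n : ℕ, (Fin n → α) → ℝ) : Prop where
  nonneg : ∀ n w, 0 ≤ p n w
  zero : ∀ w, p 0 w = 1
  sum_snoc : ∀ n (w : Fin n → α), ∑ a, p (n + 1) (Fin.snoc w a : Fin (n + 1) → α) = p n w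
  sum_cons : ∀ n (w : Fin n → α), ∑ a, p (n + 1) (Fin.cons a w : Fin (n + 1) → α) = p n w

/-- The Shannon entropy of the words of length `n`. -/
def lawEntropy (p : ∀ n : ℕ, (Fin n → α) → ℝ) (n : ℕ) : ℝ :=
  ∑ w, Real.negMulLog (p n w)

/-- The mean of `log P` over the pairs of successive letters, for a transition matrix `P`. Minus
this number is the entropy rate of a stationary Markov chain with transition matrix `P`. -/
def meanLog (p : ∀ n : ℕ, (Fin n → α) → ℝ) (P : α → α → ℝ) : ℝ :=
  ∑ w : Fin 2 → α, p 2 w * Real.log (P (w 0) (w 1))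

/-- `p` is the law of a Markov chain with transition matrix `P`. -/
def IsMarkovLaw (p : ∀ n : ℕ, (Fin n → α) → ℝ) (P : α → α → ℝ) : Prop :=
  ∀ n (w : Fin (n + 2) → α), p (n + 2) w =
    p (n + 1) (Fin.init w) * P (w (Fin.last n).castSucc) (w (Fin.last (n + 1)))

namespace IsBlockLaw

variable {p : ∀ n : ℕ, (Fin n → α) → ℝ} {n : ℕ}

lemma snoc_le (hp : IsBlockLaw p) (w : Fin n → α) (a : α) :
    p (n + 1) (Fin.snoc w a : Fin (n + 1) → α) ≤ p n w :=
  (Finset.single_le_sum (f := fun a => p (n + 1) (Fin.snoc w a : Fin (n + 1) → α))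
    (fun _ _ => hp.nonneg _ _) (Finset.mem_univ a)).trans (hp.sum_snoc n w).le

lemma cons_le (hp : IsBlockLaw p) (w : Fin n → α) (a : α) :
    p (n + 1) (Fin.cons a w : Fin (n + 1) → α) ≤ p n w :=
  (Finset.single_le_sum (f := fun a => p (n + 1) (Fin.cons a w : Fin (n + 1) → α))
    (fun _ _ => hp.nonneg _ _) (Finset.mem_univ a)).trans (hp.sum_cons n w).le

lemma le_init (hp : IsBlockLaw p) (w : Fin (n + 1) → α) : p (n + 1) w ≤ p n (Fin.init w) := by
  simpa only [Fin.snoc_init_self] using hp.snoc_le (Fin.init w) (w (Fin.last n))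

lemma le_tail (hp : IsBlockLaw p) (w : Fin (n + 1) → α) : p (n + 1) w ≤ p n (Fin.tail w) := by
  simpa only [Fin.cons_self_tail] using hp.cons_le (Fin.tail w) (w 0)

lemma init_ne_zero (hp : IsBlockLaw p) {w : Fin (n + 1) → α} (hw : p (n + 1) w ≠ 0) :
    p n (Fin.init w) ≠ 0 :=
  (((hp.nonneg _ w).lt_of_ne' hw).trans_le (hp.le_init w)).ne'

lemma tail_ne_zero (hp : IsBlockLaw p) {w : Fin (n + 1) → α} (hw : p (n + 1) w ≠ 0) :
    p n (Fin.tail w) ≠ 0 :=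
  (((hp.nonneg _ w).lt_of_ne' hw).trans_le (hp.le_tail w)).ne'

lemma sum_mul_init (hp : IsBlockLaw p) (F : (Fin n → α) → ℝ) :
    ∑ w : Fin (n + 1) → α, p (n + 1) w * F (Fin.init w) = ∑ w, p n w * F w := by
  rw [sum_fin_snoc]
  simp only [Fin.init_snoc, ← Finset.sum_mul, hp.sum_snoc]

lemma sum_mul_tail (hp : IsBlockLaw p) (F : (Fin n → α) → ℝ) :
    ∑ w : Fin (n + 1) → α, p (n + 1) w * F (Fin.tail w) = ∑ w, p n w * F w := by
  rw [sum_fin_cons]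
  simp only [Fin.tail_cons, ← Finset.sum_mul, hp.sum_cons]

lemma sum_mul_last_two (hp : IsBlockLaw p) (F : α → α → ℝ) (n : ℕ) :
    ∑ w : Fin (n + 2) → α, p (n + 2) w * F (w (Fin.last n).castSucc) (w (Fin.last (n + 1))) =
      ∑ w : Fin 2 → α, p 2 w * F (w 0) (w 1) := by
  induction n with
  | zero => rfl
  | succ n ih => exact (hp.sum_mul_tail _).trans ih

lemma last_two_ne_zero (hp : IsBlockLaw p) {w : Fin (n + 2) → α} (hw : p (n + 2) w ≠ 0) :
    p 2 ![w (Fin.last n).castSucc, w (Fin.last (n + 1))] ≠ 0 := by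
  induction n with
  | zero =>
    have hw' : ![w (Fin.last 0).castSucc, w (Fin.last (0 + 1))] = w :=
      funext (Fin.forall_fin_two.2 ⟨rfl, rfl⟩)
    rwa [hw']
  | succ n ih => exact ih (hp.tail_ne_zero hw)

lemma sum_eq_one (hp : IsBlockLaw p) (n : ℕ) : ∑ w, p n w = 1 := by
  induction n with
  | zero => simp [hp.zero]
  | succ n ih => simpa [ih] using hp.sum_mul_init (n := n) fun _ => 1

lemma lawEntropy_zero (hp : IsBlockLaw p) : lawEntropy p 0 = 0 := by
  simp [lawEntropy, hp.zero]

section ConditionalEntropy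

variable {Q : (Fin (n + 1) → α) → ℝ}

lemma sum_mul_log_sub_log_init_mul (hp : IsBlockLaw p)
    (hQ : ∀ w, p (n + 1) w ≠ 0 → Q w ≠ 0) :
    ∑ w, p (n + 1) w * (Real.log (p (n + 1) w) - Real.log (p n (Fin.init w) * Q w)) =
      -(lawEntropy p (n + 1) - lawEntropy p n) - ∑ w, p (n + 1) w * Real.log (Q w) := by
  have hlog (w : Fin (n + 1) → α) :
      p (n + 1) w * (Real.log (p (n + 1) w) - Real.log (p n (Fin.init w) * Q w)) =
        p (n + 1) w * Real.log (p (n + 1) w) - p (n + 1) w * Real.log (p n (Fin.init w)) -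
          p (n + 1) w * Real.log (Q w) := by
    by_cases hw : p (n + 1) w = 0
    · simp [hw]
    · rw [Real.log_mul (hp.init_ne_zero hw) (hQ w hw)]
      ring
  simp only [hlog, Finset.sum_sub_distrib, hp.sum_mul_init fun w => Real.log (p n w), lawEntropy,
    Real.negMulLog, neg_mul, Finset.sum_neg_distrib]
  ring

lemma sum_init_mul_le_one (hp : IsBlockLaw p)
    (hQ1 : ∀ w : Fin n → α, ∑ a, Q (Fin.snoc w a : Fin (n + 1) → α) ≤ 1) :
    ∑ w, p n (Fin.init w) * Q w ≤ ∑ w, p (n + 1) w := by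
  rw [hp.sum_eq_one, ← hp.sum_eq_one n, sum_fin_snoc]
  simp only [Fin.init_snoc, ← Finset.mul_sum]
  exact Finset.sum_le_sum fun w _ => mul_le_of_le_one_right (hp.nonneg n w) (hQ1 w)

lemma lawEntropy_succ_sub_le (hp : IsBlockLaw p) (hQ0 : ∀ w, 0 ≤ Q w)
    (hQ1 : ∀ w : Fin n → α, ∑ a, Q (Fin.snoc w a : Fin (n + 1) → α) ≤ 1)
    (hQ : ∀ w, p (n + 1) w ≠ 0 → Q w ≠ 0) :
    lawEntropy p (n + 1) - lawEntropy p n ≤ -∑ w, p (n + 1) w * Real.log (Q w) := by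
  have := hp.sum_mul_log_sub_log_init_mul hQ ▸ sum_mul_log_sub_log_nonneg (hp.nonneg (n + 1))
    (fun w => mul_nonneg (hp.nonneg n _) (hQ0 w))
    (fun w => not_imp_not.1 fun hw => mul_ne_zero (hp.init_ne_zero hw) (hQ w hw))
    (hp.sum_init_mul_le_one hQ1)
  linarith

lemma eq_init_mul_of_le_lawEntropy_succ_sub (hp : IsBlockLaw p) (hQ0 : ∀ w, 0 ≤ Q w)
    (hQ1 : ∀ w : Fin n → α, ∑ a, Q (Fin.snoc w a : Fin (n + 1) → α) ≤ 1)
    (hQ : ∀ w, p (n + 1) w ≠ 0 → Q w ≠ 0)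
    (h : -∑ w, p (n + 1) w * Real.log (Q w) ≤ lawEntropy p (n + 1) - lawEntropy p n)
    (w : Fin (n + 1) → α) : p (n + 1) w = p n (Fin.init w) * Q w := by
  refine congrFun (eq_of_sum_mul_log_sub_log_nonpos (hp.nonneg (n + 1))
    (fun w => mul_nonneg (hp.nonneg n _) (hQ0 w))
    (fun w => not_imp_not.1 fun hw => mul_ne_zero (hp.init_ne_zero hw) (hQ w hw))
    (hp.sum_init_mul_le_one hQ1) ?_) w
  rw [hp.sum_mul_log_sub_log_init_mul hQ]
  linarith

lemma lawEntropy_succ_sub_eq (hp : IsBlockLaw p)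
    (h : ∀ w, p (n + 1) w = p n (Fin.init w) * Q w) :
    lawEntropy p (n + 1) - lawEntropy p n = -∑ w, p (n + 1) w * Real.log (Q w) := by
  have hsum := hp.sum_mul_log_sub_log_init_mul (Q := Q) fun w hw =>
    right_ne_zero_of_mul (h w ▸ hw)
  simp only [← h, sub_self, mul_zero, Finset.sum_const_zero] at hsum
  linarith

end ConditionalEntropy

lemma antitone_lawEntropy_succ_sub (hp : IsBlockLaw p) :
    Antitone fun n => lawEntropy p (n + 1) - lawEntropy p n := by
  refine antitone_nat_of_succ_le fun n => ?_
  set Q : (Fin (n + 2) → α) → ℝ := fun w => p (n + 1) (Fin.tail w) / p n (Fin.init (Fin.tail w))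
  have hne (w : Fin (n + 2) → α) (hw : p (n + 2) w ≠ 0) :
      p (n + 1) (Fin.tail w) ≠ 0 ∧ p n (Fin.init (Fin.tail w)) ≠ 0 :=
    ⟨hp.tail_ne_zero hw, hp.init_ne_zero (hp.tail_ne_zero hw)⟩
  have hQ1 (w : Fin (n + 1) → α) : ∑ a, Q (Fin.snoc w a : Fin (n + 2) → α) ≤ 1 := by
    have htail (a : α) : Fin.tail (Fin.snoc w a : Fin (n + 2) → α) =
        (Fin.snoc (Fin.tail w) a : Fin (n + 1) → α) := by
      conv_lhs => rw [← Fin.cons_self_tail w, ← Fin.cons_snoc_eq_snoc_cons]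
      exact Fin.tail_cons _ _
    simp only [Q, htail, Fin.init_snoc, ← Finset.sum_div, hp.sum_snoc]
    exact div_self_le_one _
  have hlog (w : Fin (n + 2) → α) : p (n + 2) w * Real.log (Q w) =
      p (n + 2) w * (Real.log (p (n + 1) (Fin.tail w)) -
        Real.log (p n (Fin.init (Fin.tail w)))) := by
    by_cases hw : p (n + 2) w = 0
    · simp [hw]
    · rw [Real.log_div (hne w hw).1 (hne w hw).2]
  have hsum : ∑ w, p (n + 2) w * Real.log (Q w) =
      ∑ w, p (n + 1) w * Real.log (p (n + 1) w) - ∑ w, p n w * Real.log (p n w) := by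
    rw [Finset.sum_congr rfl fun w _ => hlog w,
      hp.sum_mul_tail fun w => Real.log (p (n + 1) w) - Real.log (p n (Fin.init w))]
    simp only [mul_sub, Finset.sum_sub_distrib, hp.sum_mul_init fun w => Real.log (p n w)]
  have hle := hp.lawEntropy_succ_sub_le (Q := Q) (fun w => div_nonneg (hp.nonneg _ _)
    (hp.nonneg _ _)) hQ1 fun w hw => div_ne_zero (hne w hw).1 (hne w hw).2
  rw [hsum] at hle
  simpa only [lawEntropy, Real.negMulLog, neg_mul, Finset.sum_neg_distrib, neg_sub,
    sub_neg_eq_add, neg_add_eq_sub] using hle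

lemma monotone_lawEntropy (hp : IsBlockLaw p) : Monotone (lawEntropy p) := by
  refine monotone_nat_of_le_succ fun n => ?_
  have hle : ∑ w, p (n + 1) w * Real.log (p (n + 1) w) ≤
      ∑ w, p (n + 1) w * Real.log (p n (Fin.init w)) := by
    refine Finset.sum_le_sum fun w _ => ?_
    obtain hw | hw := (hp.nonneg _ w).eq_or_lt
    · simp [← hw]
    · gcongr
      exact hp.le_init w
  simpa [hp.sum_mul_init fun w => Real.log (p n w), lawEntropy, Real.negMulLog] using hle

lemma exists_tendsto_lawEntropy_succ_sub (hp : IsBlockLaw p) :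
    ∃ h, Tendsto (fun n => lawEntropy p (n + 1) - lawEntropy p n) atTop (𝓝 h) :=
  ⟨_, tendsto_atTop_ciInf hp.antitone_lawEntropy_succ_sub
    ⟨0, by rintro _ ⟨n, rfl⟩; exact sub_nonneg.2 (hp.monotone_lawEntropy n.le_succ)⟩⟩

lemma limsup_lawEntropy_div_eq (hp : IsBlockLaw p) {h : ℝ}
    (hh : Tendsto (fun n => lawEntropy p (n + 1) - lawEntropy p n) atTop (𝓝 h)) :
    limsup (fun n : ℕ => lawEntropy p n / n) atTop = h := by
  have := hh.cesaro
  simp only [Finset.sum_range_sub, hp.lawEntropy_zero, sub_zero] at this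
  simpa only [div_eq_inv_mul] using this.limsup_eq

lemma limsup_lawEntropy_div_le (hp : IsBlockLaw p) (n : ℕ) :
    limsup (fun n : ℕ => lawEntropy p n / n) atTop ≤ lawEntropy p (n + 1) - lawEntropy p n := by
  obtain ⟨h, hh⟩ := hp.exists_tendsto_lawEntropy_succ_sub
  rw [hp.limsup_lawEntropy_div_eq hh]
  exact hp.antitone_lawEntropy_succ_sub.le_of_tendsto hh n

section Markov

variable {P : α → α → ℝ}

lemma limsup_lawEntropy_div_le_neg_meanLog (hp : IsBlockLaw p) (hP0 : ∀ i j, 0 ≤ P i j)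
    (hP1 : ∀ i, ∑ j, P i j = 1) (hP : ∀ i j, p 2 ![i, j] ≠ 0 → P i j ≠ 0) :
    limsup (fun n : ℕ => lawEntropy p n / n) atTop ≤ -meanLog p P := by
  refine (hp.limsup_lawEntropy_div_le 1).trans ?_
  exact hp.lawEntropy_succ_sub_le (Q := fun w => P (w 0) (w 1)) (fun w => hP0 _ _)
    (fun w => (hP1 (w 0)).le) fun w hw => hP _ _ (hp.last_two_ne_zero hw)

lemma isMarkovLaw_of_le_limsup (hp : IsBlockLaw p) (hP0 : ∀ i j, 0 ≤ P i j)
    (hP1 : ∀ i, ∑ j, P i j = 1) (hP : ∀ i j, p 2 ![i, j] ≠ 0 → P i j ≠ 0)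
    (h : -meanLog p P ≤ limsup (fun n : ℕ => lawEntropy p n / n) atTop) : IsMarkovLaw p P := by
  intro n
  refine hp.eq_init_mul_of_le_lawEntropy_succ_sub
    (Q := fun w => P (w (Fin.last n).castSucc) (w (Fin.last (n + 1)))) (fun w => hP0 _ _)
    (fun w => ?_) (fun w hw => hP _ _ (hp.last_two_ne_zero hw)) ?_
  · simp only [Fin.snoc_castSucc, Fin.snoc_last, hP1, le_refl]
  · rw [hp.sum_mul_last_two fun i j => Real.log (P i j)]
    exact h.trans (hp.limsup_lawEntropy_div_le (n + 1))

lemma limsup_lawEntropy_div_of_isMarkovLaw (hp : IsBlockLaw p) (hM : IsMarkovLaw p P) :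
    limsup (fun n : ℕ => lawEntropy p n / n) atTop = -meanLog p P := by
  refine hp.limsup_lawEntropy_div_eq ((tendsto_add_atTop_iff_nat 1).1 ?_)
  have hinc (n : ℕ) : lawEntropy p (n + 1 + 1) - lawEntropy p (n + 1) = -meanLog p P := by
    rw [hp.lawEntropy_succ_sub_eq (hM n), hp.sum_mul_last_two fun i j => Real.log (P i j), meanLog]
  simp only [hinc, tendsto_const_nhds]

end Markov

end IsBlockLaw

end BlockLaw

section Cylinder

variable {V : Type*} {n : ℕ}

lemma cylinder_eq_iInter (a : ℤ) (w : Fin n → V) :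
    cylinder a w = ⋂ i : Fin n, (fun ω : ℤ → V => ω (a + (i : ℕ))) ⁻¹' {w i} := by
  ext ω
  simp [cylinder]

lemma cylinder_snoc (a : ℤ) (w : Fin n → V) (x : V) :
    cylinder a (Fin.snoc w x : Fin (n + 1) → V) = {ω | ω (a + n) = x} ∩ cylinder a w := by
  ext ω
  simp [cylinder, Fin.forall_fin_succ', and_comm]

lemma cylinder_cons (a : ℤ) (w : Fin n → V) (x : V) :
    cylinder a (Fin.cons x w : Fin (n + 1) → V) = {ω | ω a = x} ∩ cylinder (a + 1) w := by
  ext ω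
  simp [cylinder, Fin.forall_fin_succ, add_assoc, add_comm (1 : ℤ)]

lemma preimage_shift_cylinder (a : ℤ) (w : Fin n → V) :
    shift ⁻¹' cylinder a w = cylinder (a + 1) w := by
  ext ω
  simp [cylinder, shift, add_right_comm]

variable [MeasurableSpace V]

lemma measurable_shift : Measurable (shift : (ℤ → V) → ℤ → V) :=
  measurable_pi_lambda _ fun _ => measurable_pi_apply _

variable [MeasurableSingletonClass V] {μ ν : Measure (ℤ → V)}

lemma measurableSet_cylinder (a : ℤ) (w : Fin n → V) : MeasurableSet (cylinder a w) := by
  rw [cylinder_eq_iInter]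
  exact .iInter fun i => measurable_pi_apply _ (measurableSet_singleton (w i))

lemma measure_cylinder_add_one (hμ : μ.map shift = μ) (a : ℤ) (w : Fin n → V) :
    μ (cylinder (a + 1) w) = μ (cylinder a w) := by
  rw [← preimage_shift_cylinder, ← Measure.map_apply measurable_shift (measurableSet_cylinder a w),
    hμ]

lemma measure_cylinder_eq (hμ : μ.map shift = μ) (a : ℤ) (w : Fin n → V) :
    μ (cylinder a w) = μ (cylinder 0 w) := by
  induction a with
  | zero => rfl
  | succ a ih => rw [measure_cylinder_add_one hμ, ih]
  | pred a ih => rw [← ih, ← measure_cylinder_add_one hμ (-(a : ℤ) - 1), sub_add_cancel]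

lemma ext_of_measure_cylinder [Countable V] [IsFiniteMeasure μ]
    (h : ∀ (a : ℤ) (n : ℕ) (w : Fin n → V), μ (cylinder a w) = ν (cylinder a w)) : μ = ν := by
  refine IsProjectiveLimit.unique (P := fun I => μ.map I.restrict) (fun I => rfl) fun I => ?_
  set N := I.sup Int.natAbs
  have hN (i : I) : (i : ℤ).natAbs ≤ N := Finset.le_sup i.2
  set block : (ℤ → V) → Fin (2 * N + 1) → V := fun ω i => ω (-N + (i : ℕ))
  have hblock : Measurable block := measurable_pi_lambda _ fun _ => measurable_pi_apply _
  set proj : (Fin (2 * N + 1) → V) → I → V := fun u i =>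
    u ⟨((i : ℤ) + N).toNat, by have := hN i; omega⟩
  have hproj : Measurable proj := measurable_pi_lambda _ fun _ => measurable_pi_apply _
  have hcomp : I.restrict = proj ∘ block := by
    funext ω i
    have := hN i
    exact congrArg ω (by simp only; omega)
  have hmap : ν.map block = μ.map block := by
    refine Measure.ext_of_singleton fun w => ?_
    have hpre : block ⁻¹' {w} = cylinder (-N) w := by
      ext ω
      exact funext_iff
    rw [Measure.map_apply hblock (measurableSet_singleton w),
      Measure.map_apply hblock (measurableSet_singleton w), hpre, h]
  simp only [hcomp, ← Measure.map_map hproj hblock, hmap]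

lemma map_shift_eq_of_measure_cylinder [Countable V] [IsFiniteMeasure μ]
    (h : ∀ (a : ℤ) (n : ℕ) (w : Fin n → V), μ (cylinder (a + 1) w) = μ (cylinder a w)) :
    μ.map shift = μ :=
  ext_of_measure_cylinder fun a n w => by
    rw [Measure.map_apply measurable_shift (measurableSet_cylinder a w), preimage_shift_cylinder, h]

end Cylinder

section Extension

variable {α : Type*} [Fintype α] {p : ∀ n : ℕ, (Fin n → α) → ℝ}

lemma IsBlockLaw.sum_mul_block (hp : IsBlockLaw p) {n k l : ℕ} (h : k + l ≤ n)
    (F : (Fin l → α) → ℝ) :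
    ∑ u : Fin n → α, p n u * F (fun i => u ⟨k + i, by omega⟩) = ∑ w, p l w * F w := by
  induction n generalizing k with
  | zero =>
    obtain ⟨rfl, rfl⟩ : k = 0 ∧ l = 0 := by omega
    simp [Subsingleton.elim _ (finZeroElim : Fin 0 → α)]
  | succ n ih =>
    obtain hkl | hkl := h.lt_or_eq
    · exact (hp.sum_mul_init fun v => F fun i => v ⟨k + i, by omega⟩).trans
        (ih (Nat.lt_succ_iff.1 hkl))
    · cases k with
      | zero =>
        obtain rfl : l = n + 1 := by omega
        simp
      | succ k =>
        have := (hp.sum_mul_tail fun v => F fun i => v ⟨k + i, by omega⟩).trans (ih (by omega))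
        simpa only [Fin.tail, Fin.succ_mk, Nat.add_right_comm k _ 1] using this

variable [MeasurableSpace α] [MeasurableSingletonClass α]

lemma IsBlockLaw.exists_probabilityMeasure_window (hp : IsBlockLaw p) (N : ℕ) :
    ∃ ν : ProbabilityMeasure (ℤ → α), ∀ (a : ℤ) (n : ℕ) (w : Fin n → α), -N ≤ a → a + n ≤ N →
      (ν : Measure (ℤ → α)) (cylinder a w) = ENNReal.ofReal (p n w) := by
  classical
  have hsum : ∑ u : Fin (2 * N + 1) → α, ENNReal.ofReal (p _ u) = 1 := by
    rw [← ENNReal.ofReal_sum_of_nonneg fun u _ => hp.nonneg _ u, hp.sum_eq_one, ENNReal.ofReal_one]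
  set extend : (Fin (2 * N + 1) → α) → ℤ → α := fun u i => u (Fin.ofNat _ (i + N).toNat)
  have hext : Measurable extend := .of_discrete
  refine ⟨⟨(PMF.ofFintype _ hsum).toMeasure.map extend,
    Measure.isProbabilityMeasure_map hext.aemeasurable⟩, fun a n w ha hn => ?_⟩
  obtain ⟨k, hk⟩ : ∃ k : ℕ, a + N = k := ⟨(a + N).toNat, by omega⟩
  have hkn : k + n ≤ 2 * N + 1 := by omega
  have hpre : extend ⁻¹' cylinder a w = {u | (fun i : Fin n => u ⟨k + i, by omega⟩) = w} := by
    ext u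
    refine (forall_congr' fun i => ?_).trans funext_iff.symm
    have hi : Fin.ofNat (2 * N + 1) (a + (i : ℕ) + N).toNat = ⟨k + i, by omega⟩ := by
      ext
      simp only [Fin.ofNat]
      rw [Nat.mod_eq_of_lt] <;> omega
    simp only [extend, hi]
  have hmarg := hp.sum_mul_block hkn fun v => if v = w then 1 else 0
  simp only [mul_ite, mul_one, mul_zero, Finset.sum_ite_eq', Finset.mem_univ, if_true] at hmarg
  rw [ProbabilityMeasure.coe_mk, Measure.map_apply hext (measurableSet_cylinder a w), hpre,
    PMF.toMeasure_ofFintype_apply _ _ .of_discrete, tsum_fintype, ← hmarg,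
    ENNReal.ofReal_sum_of_nonneg fun u _ => by split_ifs <;> simp [hp.nonneg]]
  refine Finset.sum_congr rfl fun u _ => ?_
  simp only [Set.indicator_apply, Set.mem_ofPred_eq]
  split_ifs <;> simp

-- The process is a weak limit of measures with the prescribed distributions on finite windows.
lemma IsBlockLaw.exists_measure (hp : IsBlockLaw p) :
    ∃ μ : Measure (ℤ → α), IsProbabilityMeasure μ ∧
      ∀ (a : ℤ) (n : ℕ) (w : Fin n → α), μ.real (cylinder a w) = p n w := by
  let : TopologicalSpace α := ⊥
  have : DiscreteTopology α := ⟨rfl⟩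
  have : BorelSpace α := inferInstance
  choose ν hν using hp.exists_probabilityMeasure_window
  obtain ⟨μ, -, hμ⟩ := isCompact_univ.ultrafilter_le_nhds
    ((hyperfilter ℕ : Ultrafilter ℕ).map ν) (by simp)
  refine ⟨μ, inferInstance, fun a n w => ?_⟩
  have hclopen : IsClopen (cylinder a w) := by
    rw [cylinder_eq_iInter]
    exact isClopen_iInter_of_finite fun i =>
      (isClopen_discrete {w i}).preimage (continuous_apply _)
  have hlim : Tendsto (fun N => (ν N : Measure (ℤ → α)) (cylinder a w)) (hyperfilter ℕ)
      (𝓝 ((μ : Measure (ℤ → α)) (cylinder a w))) := by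
    simpa only [ProbabilityMeasure.ennreal_coeFn_eq_coeFn_toMeasure] using
      ENNReal.tendsto_coe.2 (ProbabilityMeasure.tendsto_measure_of_isClopen_of_tendsto hμ hclopen)
  have hconst : Tendsto (fun N => (ν N : Measure (ℤ → α)) (cylinder a w)) (hyperfilter ℕ)
      (𝓝 (ENNReal.ofReal (p n w))) := by
    refine (tendsto_atTop_of_eventually_const (i₀ := a.natAbs + n) fun N hN => ?_).mono_left
      Nat.hyperfilter_le_atTop
    exact hν N a n w (by omega) (by omega)
  rw [measureReal_def, tendsto_nhds_unique hlim hconst, ENNReal.toReal_ofReal (hp.nonneg n w)]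

end Extension

section MarkovLaw

variable {α : Type*} {π : α → ℝ} {P : α → α → ℝ}

/-- The law of the Markov chain with initial distribution `π` and transition matrix `P`. -/
def markovLaw (π : α → ℝ) (P : α → α → ℝ) : ∀ n : ℕ, (Fin n → α) → ℝ
  | 0, _ => 1
  | _ + 1, w => π (w 0) * ∏ i, P (w (Fin.castSucc i)) (w i.succ)

lemma isMarkovLaw_markovLaw : IsMarkovLaw (markovLaw π P) P := by
  intro n w
  simp only [markovLaw, Fin.prod_univ_castSucc (n := n), Fin.init, mul_assoc, Fin.succ_last,
    Fin.castSucc_zero', Fin.succ_castSucc]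

lemma IsMarkovLaw.eq_markovLaw {p : ∀ n : ℕ, (Fin n → α) → ℝ} (hM : IsMarkovLaw p P)
    (h0 : ∀ w, p 0 w = 1) (h1 : ∀ i, p 1 (fun _ => i) = π i) : p = markovLaw π P := by
  funext n w
  cases n with
  | zero => exact h0 w
  | succ n =>
    induction n with
    | zero =>
      rw [← funext (Fin.forall_fin_one.2 rfl : ∀ i : Fin 1, w 0 = w i), h1]
      simp [markovLaw]
    | succ n ih => rw [hM, isMarkovLaw_markovLaw, ih]

variable [Fintype α]

lemma isBlockLaw_markovLaw (hP0 : ∀ i j, 0 ≤ P i j) (hP1 : ∀ i, ∑ j, P i j = 1)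
    (hπ0 : ∀ i, 0 ≤ π i) (hπ1 : ∑ i, π i = 1) (hstat : ∀ j, ∑ i, π i * P i j = π j) :
    IsBlockLaw (markovLaw π P) where
  nonneg
    | 0, _ => zero_le_one
    | _ + 1, _ => mul_nonneg (hπ0 _) (Finset.prod_nonneg fun _ _ => hP0 _ _)
  zero _ := rfl
  sum_snoc
    | 0, w => by simpa [markovLaw, Fin.snoc] using hπ1
    | n + 1, w => by
      simp only [isMarkovLaw_markovLaw n (Fin.snoc w _), Fin.init_snoc, Fin.snoc_castSucc,
        Fin.snoc_last, ← Finset.mul_sum, hP1, mul_one]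
  sum_cons
    | 0, w => by simp [markovLaw, hπ1]
    | n + 1, w => by
      simp only [markovLaw, Fin.prod_univ_succ (n := n), Fin.cons_zero, Fin.castSucc_zero',
        Fin.castSucc_succ, Fin.cons_succ, ← mul_assoc, ← Finset.sum_mul, hstat]

lemma IsMarkovLaw.sum_mul_eq {p : ∀ n : ℕ, (Fin n → α) → ℝ} (hM : IsMarkovLaw p P)
    (hp : IsBlockLaw p) (j : α) : ∑ i, p 1 (fun _ => i) * P i j = p 1 (fun _ => j) := by
  rw [← hp.sum_cons 1]
  refine Finset.sum_congr rfl fun i _ => ?_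
  have hinit : Fin.init (Fin.cons i fun _ => j : Fin 2 → α) = fun _ => i := by
    funext l
    rw [Subsingleton.elim l 0]
    rfl
  rw [hM, hinit]
  rfl

end MarkovLaw

section InvariantMeasure

variable {V : Type*} [MeasurableSpace V] {H : DiGraph V} {W : V → V → ℝ} {ν : Measure (ℤ → V)}

lemma ae_mem_verts (hν : ν ∈ invariantMeasures H) : ∀ᵐ ω ∂ν, ∀ i, ω i ∈ H.verts :=
  hν.2.2.mono fun _ hω i => H.fst_mem (hω i)

lemma measure_cylinder_eq_zero (hν : ν ∈ invariantMeasures H) {n : ℕ} {a : ℤ} {w : Fin n → V}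
    {i : Fin n} (hi : w i ∉ H.verts) : ν (cylinder a w) = 0 :=
  measure_mono_null (fun ω hω (hall : ∀ j, ω j ∈ H.verts) => hi (hω i ▸ hall _))
    (ae_iff.1 (ae_mem_verts hν))

/-- The finite-dimensional distributions of a stationary process carried by the vertices of `H`. -/
def blockLaw (H : DiGraph V) (ν : Measure (ℤ → V)) (n : ℕ) (w : Fin n → H.verts) : ℝ :=
  ν.real (cylinder 0 fun i => (w i : V))

lemma adj_of_blockLaw_ne_zero (hν : ν ∈ invariantMeasures H) {i j : H.verts}
    (h : blockLaw H ν 2 ![i, j] ≠ 0) : H.Adj i j := by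
  contrapose! h
  have hsub : cylinder 0 (fun l => (![i, j] l : V)) ⊆ {ω | ω ∉ H.pathSpace} := fun ω hω hpath =>
    h (by simpa [← show ω 0 = i from hω 0, ← show ω 1 = j from hω 1] using hpath 0)
  rw [blockLaw, measureReal_def, measure_mono_null hsub (ae_iff.1 hν.2.2), ENNReal.toReal_zero]

lemma ae_forall_of_measure_cylinder_two_eq_zero [Countable V] {r : V → V → Prop}
    (h : ∀ a i j, ¬ r i j → ν (cylinder a ![i, j]) = 0) :
    ∀ᵐ ω ∂ν, ∀ a, r (ω a) (ω (a + 1)) := by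
  refine ae_all_iff.2 fun a => measure_mono_null
    (t := ⋃ q : {q : V × V // ¬ r q.1 q.2}, cylinder a ![q.1.1, q.1.2]) (fun ω hω => ?_)
    (measure_iUnion_null fun q => h a _ _ q.2)
  exact Set.mem_iUnion.2 ⟨⟨(ω a, ω (a + 1)), hω⟩, by simp [cylinder, Fin.forall_fin_two]⟩

lemma blockEntropy_eq_lawEntropy [Fintype H.verts] (hν : ν ∈ invariantMeasures H) (n : ℕ) :
    blockEntropy ν n = lawEntropy (blockLaw H ν) n := by
  have hinj : Function.Injective fun (w : Fin n → H.verts) (i : Fin n) => (w i : V) :=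
    fun w w' h => funext fun i => Subtype.ext (congrFun h i)
  rw [blockEntropy, lawEntropy, ← tsum_fintype (L := SummationFilter.unconditional _)]
  refine (hinj.tsum_eq fun w hw => ?_).symm
  have hmem (i : Fin n) : w i ∈ H.verts := by
    by_contra hi
    exact hw (by simp [measureReal_def, measure_cylinder_eq_zero hν hi])
  exact ⟨fun i => ⟨w i, hmem i⟩, rfl⟩

variable [MeasurableSingletonClass V]

lemma eq_of_blockLaw_eq [Countable V] {μ : Measure (ℤ → V)} (hμ : μ ∈ invariantMeasures H)
    (hν : ν ∈ invariantMeasures H) (h : blockLaw H ν = blockLaw H μ) : ν = μ := by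
  have := hμ.1
  have := hν.1
  refine ext_of_measure_cylinder fun a n w => ?_
  by_cases hw : ∀ i, w i ∈ H.verts
  · rw [measure_cylinder_eq hν.2.1, measure_cylinder_eq hμ.2.1]
    exact (measureReal_eq_measureReal_iff).1 (congrFun₂ h n fun i => ⟨w i, hw i⟩)
  · obtain ⟨i, hi⟩ := not_forall.1 hw
    rw [measure_cylinder_eq_zero hμ hi, measure_cylinder_eq_zero hν hi]

lemma measurableSet_pathSpace [Countable V] (H : DiGraph V) : MeasurableSet H.pathSpace := by
  have hpath : H.pathSpace =
      ⋂ i : ℤ, (fun ω : ℤ → V => (ω i, ω (i + 1))) ⁻¹' {q | H.Adj q.1 q.2} := by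
    ext ω
    simp [DiGraph.pathSpace]
  rw [hpath]
  exact .iInter fun i => ((measurable_pi_apply i).prodMk (measurable_pi_apply (i + 1)))
    (Set.to_countable _).measurableSet

variable [Fintype H.verts]

lemma exists_invariantMeasure_blockLaw_eq [Countable V] {p : ∀ n : ℕ, (Fin n → H.verts) → ℝ}
    (hp : IsBlockLaw p) (hadj : ∀ i j, p 2 ![i, j] ≠ 0 → H.Adj i j) :
    ∃ μ ∈ invariantMeasures H, blockLaw H μ = p := by
  obtain ⟨m, hm, hmp⟩ := hp.exists_measure
  set c : (ℤ → H.verts) → ℤ → V := fun ω i => ω i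
  have hc : Measurable c :=
    measurable_pi_lambda _ fun i => measurable_subtype_coe.comp (measurable_pi_apply i)
  have hshift : m.map shift = m := map_shift_eq_of_measure_cylinder fun a n w =>
    (measureReal_eq_measureReal_iff).1 (by rw [hmp, hmp])
  refine ⟨m.map c, ⟨Measure.isProbabilityMeasure_map hc.aemeasurable, ?_, ?_⟩, ?_⟩
  · have hcomm : shift ∘ c = c ∘ shift := rfl
    rw [Measure.map_map measurable_shift hc, hcomm, ← Measure.map_map hc measurable_shift, hshift]
  · refine (ae_map_iff hc.aemeasurable (measurableSet_pathSpace H)).2 ?_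
    refine ae_forall_of_measure_cylinder_two_eq_zero (r := fun i j : H.verts => H.Adj i j)
      fun a i j hij => ?_
    rw [← measureReal_eq_zero_iff, hmp]
    exact not_not.1 (mt (hadj i j) hij)
  · funext n w
    rw [blockLaw, map_measureReal_apply hc (measurableSet_cylinder _ _), ← hmp 0]
    congr 1
    ext ω
    simp [c, cylinder, Subtype.ext_iff]

lemma measureReal_eq_sum_inter (hν : ν ∈ invariantMeasures H) (a : ℤ) (A : Set (ℤ → V)) :
    ν.real A = ∑ x : H.verts, ν.real ({ω | ω a = x} ∩ A) := by
  have := hν.1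
  have hmeas (x : V) : MeasurableSet ((fun ω : ℤ → V => ω a) ⁻¹' {x}) :=
    measurable_pi_apply a (measurableSet_singleton x)
  have hA : ν A = ν.restrict A ((fun ω => ω a) ⁻¹' H.verts.toFinset) := by
    rw [Measure.restrict_apply (measurable_pi_apply a H.verts.toFinset.measurableSet)]
    refine (measure_congr ?_).symm
    filter_upwards [ae_mem_verts hν] with ω hω
    exact propext (and_iff_right (by simpa using hω a))
  simp only [measureReal_def]
  rw [hA, ← sum_measure_preimage_singleton _ fun x _ => hmeas x,
    ENNReal.toReal_sum fun _ _ => measure_ne_top _ _,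
    Finset.sum_subtype _ (fun x => Set.mem_toFinset)]
  exact Finset.sum_congr rfl fun x _ => congrArg _ (Measure.restrict_apply (hmeas x))

lemma isBlockLaw_blockLaw (hν : ν ∈ invariantMeasures H) : IsBlockLaw (blockLaw H ν) where
  nonneg _ _ := measureReal_nonneg
  zero w := by
    have := hν.1
    simp [blockLaw, cylinder]
  sum_snoc n w := by
    rw [blockLaw, measureReal_eq_sum_inter hν n]
    refine Finset.sum_congr rfl fun x _ => ?_
    rw [blockLaw, ← zero_add (n : ℤ), ← cylinder_snoc]
    exact congrArg (fun u => ν.real (cylinder 0 u)) (Fin.comp_snoc (g := Subtype.val) w x)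
  sum_cons n w := by
    rw [blockLaw, measureReal_def, ← measure_cylinder_eq hν.2.1 1, ← measureReal_def,
      measureReal_eq_sum_inter hν 0]
    refine Finset.sum_congr rfl fun x _ => ?_
    rw [blockLaw, ← zero_add (1 : ℤ), ← cylinder_cons]
    exact congrArg (fun u => ν.real (cylinder 0 u)) (Fin.comp_cons (g := Subtype.val) x w)

lemma integral_log_eq_meanLog (hν : ν ∈ invariantMeasures H) :
    ∫ ω, Real.log (W (ω 0) (ω 1)) ∂ν = meanLog (blockLaw H ν) fun i j => W i j := by
  classical
  have := hν.1
  have hae : (fun ω : ℤ → V => Real.log (W (ω 0) (ω 1))) =ᵐ[ν] fun ω =>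
      ∑ w : Fin 2 → H.verts, (cylinder 0 fun i => (w i : V)).indicator
        (fun _ => Real.log (W (w 0) (w 1))) ω := by
    filter_upwards [ae_mem_verts hν] with ω hω
    rw [Finset.sum_eq_single_of_mem (fun i : Fin 2 => (⟨ω (0 + (i : ℕ)), hω _⟩ : H.verts))
      (Finset.mem_univ _), Set.indicator_of_mem (show ω ∈ cylinder 0 _ from fun i => rfl)]
    · simp
    · exact fun w _ hw => Set.indicator_of_notMem
        (fun h => hw (funext fun i => Subtype.ext (h i).symm)) _
  rw [integral_congr_ae hae, integral_finsetSum _ fun w _ =>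
    (integrable_const _).indicator (measurableSet_cylinder _ _)]
  exact Finset.sum_congr rfl fun w _ =>
    integral_indicator_const _ (measurableSet_cylinder _ _)

end InvariantMeasure

section Equilibrium

lemma IsBlockLaw.meanLog_eq_log_add_meanLog {α : Type*} [Fintype α]
    {p : ∀ n : ℕ, (Fin n → α) → ℝ} (hp : IsBlockLaw p) {Q P : α → α → ℝ} {r : ℝ} {x : α → ℝ}
    (hr : 0 < r) (hx : ∀ i, 0 < x i) (hQ : ∀ i j, p 2 ![i, j] ≠ 0 → 0 < Q i j)
    (hP : ∀ i j, p 2 ![i, j] ≠ 0 → P i j = r * Q i j * x j / x i) :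
    meanLog p P = Real.log r + meanLog p Q := by
  have hlog (w : Fin 2 → α) : p 2 w * Real.log (P (w 0) (w 1)) =
      p 2 w * Real.log r + p 2 w * Real.log (Q (w 0) (w 1)) +
        (p 2 w * Real.log (x (w 1)) - p 2 w * Real.log (x (w 0))) := by
    by_cases hw : p 2 w = 0
    · simp [hw]
    · have hw' : p 2 ![w 0, w 1] ≠ 0 := hp.last_two_ne_zero (n := 0) hw
      have hQ' := hQ _ _ hw'
      rw [hP _ _ hw', Real.log_div (mul_pos (mul_pos hr hQ') (hx _)).ne' (hx _).ne',
        Real.log_mul (mul_pos hr hQ').ne' (hx _).ne', Real.log_mul hr.ne' hQ'.ne']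
      ring
  have htelescope : ∑ w : Fin 2 → α, p 2 w * Real.log (x (w 1)) =
      ∑ w : Fin 2 → α, p 2 w * Real.log (x (w 0)) :=
    (hp.sum_mul_tail fun w => Real.log (x (w 0))).trans
      (hp.sum_mul_init fun w => Real.log (x (w 0))).symm
  simp only [meanLog, hlog, Finset.sum_add_distrib, Finset.sum_sub_distrib, htelescope, sub_self,
    add_zero, ← Finset.sum_mul, hp.sum_eq_one, one_mul]

variable {V : Type*} [MeasurableSpace V] [MeasurableSingletonClass V] {H : DiGraph V}
  [Fintype H.verts] {W : V → V → ℝ} {r : ℝ} {x : H.verts → ℝ} {P : H.verts → H.verts → ℝ}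

lemma pressureFunctional_eq {ν : Measure (ℤ → V)} (hν : ν ∈ invariantMeasures H)
    (hW : ∀ i j, H.Adj i j → 0 < W i j) (hr : 0 < r) (hx : ∀ i, 0 < x i)
    (hP : ∀ i j : H.verts, H.Adj i j → P i j = r * W i j * x j / x i) :
    pressureFunctional W ν = limsup (fun n : ℕ => lawEntropy (blockLaw H ν) n / n) atTop +
      meanLog (blockLaw H ν) P - Real.log r := by
  rw [(isBlockLaw_blockLaw hν).meanLog_eq_log_add_meanLog (Q := fun i j => W i j) hr hx
      (fun i j h => hW _ _ (adj_of_blockLaw_ne_zero hν h))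
      fun i j h => hP _ _ (adj_of_blockLaw_ne_zero hν h),
    pressureFunctional, entropy, integral_log_eq_meanLog hν]
  simp only [blockEntropy_eq_lawEntropy hν]
  ring

-- Parry's construction: by the Gibbs inequality the pressure of `ν` is at most `-log r`, with
-- equality exactly when `ν` is Markov with transition matrix `P`.
theorem exists_unique_isEquilibriumMeasure [Countable V] (hW : ∀ i j, H.Adj i j → 0 < W i j)
    (hr : 0 < r) (hx : ∀ i, 0 < x i)
    (hP : ∀ i j : H.verts, H.Adj i j → P i j = r * W i j * x j / x i)
    (hadj : ∀ i j : H.verts, ¬ H.Adj i j → P i j = 0) (hP1 : ∀ i, ∑ j, P i j = 1)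
    {π : H.verts → ℝ} (hπ0 : ∀ i, 0 ≤ π i) (hπ1 : ∑ i, π i = 1)
    (hstat : ∀ j, ∑ i, π i * P i j = π j)
    (huniq : ∀ π' : H.verts → ℝ, ∑ i, π' i = 1 → (∀ j, ∑ i, π' i * P i j = π' j) → π' = π) :
    ∃ μ, IsEquilibriumMeasure H W μ ∧ (∀ ν, IsEquilibriumMeasure H W ν → ν = μ) ∧
      ∀ i : H.verts, μ.real (cylinder 0 fun _ : Fin 1 => (i : V)) = π i := by
  have hPpos (i j : H.verts) (h : H.Adj i j) : 0 < P i j := by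
    rw [hP i j h]
    exact div_pos (mul_pos (mul_pos hr (hW _ _ h)) (hx j)) (hx i)
  have hP0 (i j : H.verts) : 0 ≤ P i j :=
    (em (H.Adj i j)).elim (fun h => (hPpos i j h).le) fun h => (hadj i j h).ge
  have hsupp {ν} (hν : ν ∈ invariantMeasures H) (i j : H.verts)
      (h : blockLaw H ν 2 ![i, j] ≠ 0) : P i j ≠ 0 :=
    (hPpos i j (adj_of_blockLaw_ne_zero hν h)).ne'
  have hmarkov : IsBlockLaw (markovLaw π P) := isBlockLaw_markovLaw hP0 hP1 hπ0 hπ1 hstat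
  obtain ⟨μ, hμ, hμlaw⟩ := exists_invariantMeasure_blockLaw_eq hmarkov fun i j h => by
    contrapose! h
    simp [markovLaw, hadj i j h]
  have hpressure : pressureFunctional W μ = -Real.log r := by
    rw [pressureFunctional_eq hμ hW hr hx hP, hμlaw,
      hmarkov.limsup_lawEntropy_div_of_isMarkovLaw isMarkovLaw_markovLaw]
    ring
  refine ⟨μ, ⟨hμ, fun ν hν => ?_⟩, fun ν ⟨hν, hmax⟩ => eq_of_blockLaw_eq hμ hν ?_, fun i => ?_⟩
  · have := (isBlockLaw_blockLaw hν).limsup_lawEntropy_div_le_neg_meanLog hP0 hP1 (hsupp hν)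
    rw [hpressure, pressureFunctional_eq hν hW hr hx hP]
    linarith
  · have hlaw := isBlockLaw_blockLaw hν
    have hle := hmax μ hμ
    rw [hpressure, pressureFunctional_eq hν hW hr hx hP] at hle
    have hM := hlaw.isMarkovLaw_of_le_limsup hP0 hP1 (hsupp hν) (by linarith)
    have hone : (fun i => blockLaw H ν 1 fun _ => i) = π := huniq _
      (((Equiv.funUnique (Fin 1) H.verts).symm.sum_comp (blockLaw H ν 1)).trans
        (hlaw.sum_eq_one 1)) (hM.sum_mul_eq hlaw)
    rw [hμlaw, hM.eq_markovLaw hlaw.zero (congrFun hone)]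
  · have := congrFun₂ hμlaw 1 fun _ => i
    simpa [blockLaw, markovLaw] using this

end Equilibrium

section Eigenvector

variable {V : Type*} {k : V → V → ℝ≥0∞} {v : V} {X Y : V → ℝ≥0∞}

lemma tsum_mul_passageSum (h : returnSum k v = 1) (i : V) :
    ∑' j, k i j * passageSum k v j = passageSum k v i := by
  obtain rfl | hi := eq_or_ne i v
  · rwa [passageSum_self]
  · rw [passageSum_of_ne hi]

lemma tsum_passageSum_swap_mul_of_ne {j : V} (hj : j ≠ v) :
    ∑' i, passageSum (fun i l => k l i) v i * k i j = passageSum (fun i l => k l i) v j := by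
  rw [passageSum_of_ne hj]
  exact tsum_congr fun i => mul_comm _ _

lemma tsum_mul_eq_of_forall_ne (hX : ∀ i, ∑' j, k i j * X j = X i) (hXv : X v = 1)
    (hY : ∀ j ≠ v, ∑' i, Y i * k i j = Y j) (hfin : ∑' i, Y i * X i ≠ ∞) (j : V) :
    ∑' i, Y i * k i j = Y j := by
  classical
  obtain rfl | hj := eq_or_ne j v
  swap
  · exact hY j hj
  have hpair : ∑' l, (∑' i, Y i * k i l) * X l = ∑' i, Y i * X i := by
    simp only [← ENNReal.tsum_mul_right, mul_assoc]
    rw [ENNReal.tsum_comm]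
    simp only [ENNReal.tsum_mul_left, hX]
  have hoff (l : V) : (if l = j then 0 else (∑' i, Y i * k i l) * X l) =
      if l = j then 0 else Y l * X l := by
    split_ifs with h
    · rfl
    · rw [hY l h]
  have hne : ∑' l, (if l = j then 0 else Y l * X l) ≠ ∞ :=
    ne_top_of_le_ne_top hfin (ENNReal.tsum_le_tsum fun l => by split_ifs <;> simp)
  rw [ENNReal.summable.tsum_eq_add_tsum_ite' (f := fun l => (∑' i, Y i * k i l) * X l) j,
    ENNReal.summable.tsum_eq_add_tsum_ite' (f := fun i => Y i * X i) j] at hpair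
  simp only [hoff, hXv, mul_one] at hpair
  exact (ENNReal.add_left_inj hne).1 hpair

/-- The part of `passageSum` that comes from the paths of length at least `n`. -/
def passageTail (k : V → V → ℝ≥0∞) (v : V) (n : ℕ) (j : V) : ℝ≥0∞ :=
  ∑' m, firstPassage k v (m + n) j

lemma passageTail_anti (j : V) : Antitone fun n => passageTail k v n j :=
  antitone_nat_of_succ_le fun n => by
    simpa only [passageTail, add_assoc, add_comm 1 n] using
      ENNReal.tsum_comp_le_tsum_of_injective (add_left_injective 1)
        fun m => firstPassage k v (m + n) j

lemma passageTail_succ_self (n : ℕ) : passageTail k v (n + 1) v = 0 := by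
  simp [passageTail, firstPassage]

lemma passageTail_succ_of_ne (n : ℕ) {j : V} (hj : j ≠ v) :
    passageTail k v (n + 1) j = ∑' l, k j l * passageTail k v n l := by
  simp only [passageTail, firstPassage, hj, if_false, ← ENNReal.tsum_mul_left]
  exact ENNReal.tsum_comm

lemma tsum_mul_passageTail (hY : ∀ j, ∑' i, Y i * k i j = Y j) (hYv : Y v = 1) (n : ℕ) :
    ∑' j, Y j * passageTail k v n j =
      ∑' j, Y j * passageTail k v (n + 1) j + ∑' l, k v l * passageTail k v n l := by
  classical
  have hstep (i : V) : Y i * ∑' j, k i j * passageTail k v n j =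
      Y i * passageTail k v (n + 1) i +
        if i = v then ∑' l, k v l * passageTail k v n l else 0 := by
    obtain rfl | hi := eq_or_ne i v
    · simp [passageTail_succ_self, hYv]
    · simp [passageTail_succ_of_ne n hi, hi]
  calc ∑' j, Y j * passageTail k v n j = ∑' j, ∑' i, Y i * (k i j * passageTail k v n j) := by
        simp only [← mul_assoc, ENNReal.tsum_mul_right, hY]
    _ = ∑' i, Y i * ∑' j, k i j * passageTail k v n j := by
        rw [ENNReal.tsum_comm]
        simp only [ENNReal.tsum_mul_left]
    _ = _ := by simp only [hstep, ENNReal.tsum_add, tsum_ite_eq]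

lemma succ_mul_tsum_passageTail_le (hY : ∀ j, ∑' i, Y i * k i j = Y j) (hYv : Y v = 1) (L : ℕ) :
    ((L + 1 : ℕ) : ℝ≥0∞) * ∑' l, k v l * passageTail k v L l ≤
      ∑' i, Y i * passageSum k v i := by
  set T : ℕ → ℝ≥0∞ := fun n => ∑' l, k v l * passageTail k v n l
  have hT : Antitone T := fun m n h =>
    ENNReal.tsum_le_tsum fun l => mul_le_mul_right (passageTail_anti l h) _
  have hsum (n : ℕ) : ∑ i ∈ Finset.range n, T i + ∑' j, Y j * passageTail k v n j =
      ∑' j, Y j * passageSum k v j := by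
    induction n with
    | zero => simp [passageTail, passageSum]
    | succ n ih =>
      rw [← ih, tsum_mul_passageTail hY hYv n, Finset.sum_range_succ]
      ring
  calc ((L + 1 : ℕ) : ℝ≥0∞) * T L = ∑ _i ∈ Finset.range (L + 1), T L := by simp
    _ ≤ ∑ i ∈ Finset.range (L + 1), T i :=
        Finset.sum_le_sum fun i hi => hT (Finset.mem_range_succ_iff.1 hi)
    _ ≤ ∑' i, Y i * passageSum k v i := le_self_add.trans (hsum _).le

end Eigenvector

section RankedKernel

variable {α : Type*} {k : α → α → ℝ≥0∞} {rank : α → ℕ} {o : α}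

lemma passageSum_swap_ne_top [Finite α] (hk : ∀ i j, k i j ≠ ∞)
    (hrank : ∀ i j, k i j ≠ 0 → j = o ∨ rank i < rank j) (j : α) :
    passageSum (fun i l => k l i) o j ≠ ∞ := by
  have := Fintype.ofFinite α
  induction hn : rank j using Nat.strong_induction_on generalizing j with
  | _ n ih =>
    obtain rfl | hj := eq_or_ne j o
    · simp [passageSum_self]
    · rw [passageSum_of_ne hj, tsum_fintype]
      refine ENNReal.sum_ne_top.2 fun i _ => ?_
      by_cases hij : k i j = 0
      · simp [hij]
      · exact ENNReal.mul_ne_top (hk i j)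
          (ih _ (hn ▸ (hrank i j hij).resolve_left hj) i rfl)

variable [Fintype α]

lemma toReal_eq_sum_toReal_mul {a : ℝ≥0∞} {f g : α → ℝ≥0∞} (h : ∑' i, f i * g i = a)
    (ha : a ≠ ∞) : ∑ i, (f i).toReal * (g i).toReal = a.toReal := by
  rw [tsum_fintype] at h
  rw [← h, ENNReal.toReal_sum (ENNReal.sum_ne_top.1 (h ▸ ha))]
  exact Finset.sum_congr rfl fun i _ => ENNReal.toReal_mul.symm

lemma exists_eigenvectors (hk : ∀ i j, k i j ≠ ∞)
    (hrank : ∀ i j, k i j ≠ 0 → j = o ∨ rank i < rank j)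
    (hpath : ∀ i j, Relation.ReflTransGen (fun i l => k i l ≠ 0) i j) (hret : returnSum k o = 1) :
    ∃ x y : α → ℝ, (∀ i, 0 < x i) ∧ (∀ i, 0 ≤ y i) ∧ x o = 1 ∧ y o = 1 ∧
      (∀ i, ∑ j, (k i j).toReal * x j = x i) ∧ (∀ j, ∑ i, y i * (k i j).toReal = y j) ∧
      ∀ L : ℕ, ((L + 1 : ℕ) : ℝ≥0∞) * ∑' l, k o l * passageTail k o L l ≤
        ENNReal.ofReal (∑ i, y i * x i) := by
  set X := passageSum k o
  set Y := passageSum (fun i l => k l i) o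
  have hX := tsum_mul_passageSum hret
  have hX0 (i : α) : X i ≠ 0 := passageSum_ne_zero (hpath i o)
  have hXtop (i : α) : X i ≠ ∞ := passageSum_ne_top (by simp [hret]) (hpath o i)
  have hYtop : ∀ j, Y j ≠ ∞ := passageSum_swap_ne_top hk hrank
  have hYX : ∑' i, Y i * X i ≠ ∞ := by
    rw [tsum_fintype]
    exact ENNReal.sum_ne_top.2 fun i _ => ENNReal.mul_ne_top (hYtop i) (hXtop i)
  have hY : ∀ j, ∑' i, Y i * k i j = Y j :=
    tsum_mul_eq_of_forall_ne hX passageSum_self (fun j hj => tsum_passageSum_swap_mul_of_ne hj) hYX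
  refine ⟨fun i => (X i).toReal, fun i => (Y i).toReal,
    fun i => ENNReal.toReal_pos (hX0 i) (hXtop i), fun i => ENNReal.toReal_nonneg,
    by simp [X, passageSum_self], by simp [Y, passageSum_self],
    fun i => toReal_eq_sum_toReal_mul (hX i) (hXtop i),
    fun j => toReal_eq_sum_toReal_mul (hY j) (hYtop j), fun L => ?_⟩
  rw [toReal_eq_sum_toReal_mul rfl hYX, ENNReal.ofReal_toReal hYX]
  exact succ_mul_tsum_passageTail_le hY passageSum_self L

end RankedKernel

section StationaryDistribution

variable {α : Type*} [Fintype α] {K : α → α → ℝ} {rank : α → ℕ} {o : α} {x y : α → ℝ}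

lemma eq_mul_of_rank (hK : ∀ i j, K i j ≠ 0 → j = o ∨ rank i < rank j) (hyo : y o = 1)
    (hy : ∀ j, ∑ i, y i * K i j = y j) {z : α → ℝ} (hz : ∀ j, ∑ i, z i * K i j = z j) (j : α) :
    z j = z o * y j := by
  induction hn : rank j using Nat.strong_induction_on generalizing j with
  | _ n ih =>
    obtain rfl | hj := eq_or_ne j o
    · rw [hyo, mul_one]
    · rw [← hz j, ← hy j, Finset.mul_sum]
      refine Finset.sum_congr rfl fun i _ => ?_
      by_cases hij : K i j = 0
      · simp [hij]
      · rw [ih _ (hn ▸ (hK i j hij).resolve_left hj) i rfl, mul_assoc]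

lemma stationary_of_eigenvectors (hx : ∀ i, 0 < x i) (hy : ∀ j, ∑ i, y i * K i j = y j) (j : α) :
    ∑ i, y i * x i / (∑ l, y l * x l) * (K i j * x j / x i) = y j * x j / ∑ l, y l * x l := by
  rw [← hy j, Finset.sum_mul, Finset.sum_div]
  refine Finset.sum_congr rfl fun i _ => ?_
  have := (hx i).ne'
  field_simp

lemma eq_of_stationary (hK : ∀ i j, K i j ≠ 0 → j = o ∨ rank i < rank j) (hyo : y o = 1)
    (hy : ∀ j, ∑ i, y i * K i j = y j) (hx : ∀ i, 0 < x i) (hZ : ∑ l, y l * x l ≠ 0)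
    {π : α → ℝ} (hπ1 : ∑ i, π i = 1) (hπ : ∀ j, ∑ i, π i * (K i j * x j / x i) = π j) :
    π = fun i => y i * x i / ∑ l, y l * x l := by
  have hz (j : α) : ∑ i, π i / x i * K i j = π j / x j := by
    conv_rhs => rw [← hπ j, Finset.sum_div]
    refine Finset.sum_congr rfl fun i _ => ?_
    have := (hx i).ne'
    have := (hx j).ne'
    field_simp
  have hπj (j : α) : π j = π o / x o * (y j * x j) := by
    rw [← div_mul_cancel₀ (π j) (hx j).ne', eq_mul_of_rank hK hyo hy hz j, mul_assoc]
  have hsum : π o / x o * ∑ l, y l * x l = 1 := by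
    rw [← hπ1, Finset.mul_sum]
    exact Finset.sum_congr rfl fun l _ => (hπj l).symm
  funext j
  rw [hπj j, eq_div_iff hZ, mul_right_comm, hsum, one_mul]

end StationaryDistribution

section Restriction

variable {V : Type*} {k : V → V → ℝ≥0∞} {s : Set V}

lemma tsum_subtype_mul (hs : ∀ i j, k i j ≠ 0 → j ∈ s) (f : V → ℝ≥0∞) (i : V) :
    ∑' l : s, k i l * f l = ∑' l, k i l * f l :=
  tsum_subtype_eq_of_support_subset fun l hl => hs i l (left_ne_zero_of_mul hl)

lemma firstPassage_subtype (hs : ∀ i j, k i j ≠ 0 → j ∈ s) (v : s) (n : ℕ) (j : s) :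
    firstPassage (fun i l : s => k i l) v n j = firstPassage k v n j := by
  classical
  induction n generalizing j with
  | zero => simp only [firstPassage, Subtype.ext_iff]
  | succ n ih => simp only [firstPassage, ih, Subtype.ext_iff, tsum_subtype_mul hs]

lemma reflTransGen_subtype {r : V → V → Prop} (hs : ∀ i j, r i j → j ∈ s) {u v : V} (hu : u ∈ s)
    (hv : v ∈ s) (h : Relation.ReflTransGen r u v) :
    Relation.ReflTransGen (fun i j : s => r i j) ⟨u, hu⟩ ⟨v, hv⟩ := by
  induction h using Relation.ReflTransGen.head_induction_on with
  | refl => exact .refl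
  | head h _ ih => exact .head (b := ⟨_, hs _ _ h⟩) h (ih _)

end Restriction

section Recurrence

variable {V : Type*} {H : DiGraph V} {W : V → V → ℝ} {rank : V → ℕ} {o : H.verts} {r : ℝ≥0}

lemma DiGraph.adj_of_mul_edgeWeight_ne_zero {z : ℝ≥0∞} {i j : V}
    (h : z * H.edgeWeight W i j ≠ 0) : H.Adj i j := by
  by_contra hij
  exact h (by rw [edgeWeight_of_not_adj hij, mul_zero])

/-- The weights `r * W i j` of the edges, as a kernel on the vertex set. -/
def vertsKernel (H : DiGraph V) (W : V → V → ℝ) (r : ℝ≥0) (i j : H.verts) : ℝ≥0∞ :=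
  r * H.edgeWeight W i j

lemma tsum_vertsKernel_mul_firstPassage (hW : ∀ i j, H.Adj i j → 0 < W i j) (n : ℕ) :
    ∑' l, vertsKernel H W r o l * firstPassage (vertsKernel H W r) o n l =
      H.cycleSum W o (n + 1) * r ^ (n + 1) := by
  have hs (i j : V) (h : (r : ℝ≥0∞) * H.edgeWeight W i j ≠ 0) : j ∈ H.verts :=
    H.snd_mem (DiGraph.adj_of_mul_edgeWeight_ne_zero h)
  calc ∑' l, vertsKernel H W r o l * firstPassage (vertsKernel H W r) o n l
      = ∑' l : H.verts, r * H.edgeWeight W o l *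
          firstPassage (fun i j => r * H.edgeWeight W i j) (o : V) n l :=
        tsum_congr fun l => congrArg _ (firstPassage_subtype hs o n l)
    _ = ∑' l, r * H.edgeWeight W o l *
          firstPassage (fun i j => r * H.edgeWeight W i j) (o : V) n l :=
        tsum_subtype_mul (k := fun i j => r * H.edgeWeight W i j) hs _ _
    _ = H.cycleSum W o (n + 1) * r ^ (n + 1) := by
        rw [DiGraph.cycleSum_succ hW, ← ENNReal.tsum_mul_right]
        exact tsum_congr fun l => by rw [firstPassage_const_mul]; ring

lemma tsum_vertsKernel_mul_passageTail (hW : ∀ i j, H.Adj i j → 0 < W i j) (L : ℕ) :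
    ∑' l, vertsKernel H W r o l * passageTail (vertsKernel H W r) o L l =
      ∑' n, H.cycleSum W o (n + (L + 1)) * r ^ (n + (L + 1)) := by
  simp only [passageTail, ← ENNReal.tsum_mul_left]
  rw [ENNReal.tsum_comm]
  exact tsum_congr fun n => tsum_vertsKernel_mul_firstPassage hW (n + L)

lemma returnSum_vertsKernel (hW : ∀ i j, H.Adj i j → 0 < W i j) :
    returnSum (vertsKernel H W r) o = H.genFun W o r := by
  rw [DiGraph.genFun, tsum_eq_zero_add' ENNReal.summable, DiGraph.cycleSum_zero, zero_mul,
    zero_add, ← tsum_vertsKernel_mul_passageTail hW 0]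
  rfl

lemma DiGraph.IsConnected.reflTransGen_vertsKernel (hH : H.IsConnected)
    (hW : ∀ i j, H.Adj i j → 0 < W i j) (hr : r ≠ 0) (i j : H.verts) :
    Relation.ReflTransGen (fun i j => vertsKernel H W r i j ≠ 0) i j :=
  reflTransGen_subtype (r := fun i j => (r : ℝ≥0∞) * H.edgeWeight W i j ≠ 0)
    (fun _ _ h => H.snd_mem (adj_of_mul_edgeWeight_ne_zero h)) i.2 j.2
    (hH.reflTransGen_edgeWeight hW (by simpa using hr) i.2 j.2)

theorem exists_isEquilibriumMeasure_inv_le [Countable V] [MeasurableSpace V]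
    [MeasurableSingletonClass V] (hfin : H.verts.Finite) (hH : H.IsConnected)
    (hrank : ∀ i j, H.Adj i j → j = o ∨ rank i < rank j) (hW : ∀ i j, H.Adj i j → 0 < W i j)
    (hgen : H.genFun W o r = 1) :
    ∃ μ, IsEquilibriumMeasure H W μ ∧ (∀ ν, IsEquilibriumMeasure H W ν → ν = μ) ∧
      ∀ L : ℕ, L * ∑' n, H.cycleSum W o (n + L) * r ^ (n + L) ≤
        (μ (cylinder 0 fun _ : Fin 1 => (o : V)))⁻¹ := by
  have := hfin.fintype
  have hr : r ≠ 0 := by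
    rintro rfl
    simp [DiGraph.genFun_zero] at hgen
  have hKrank (i j : H.verts) (h : vertsKernel H W r i j ≠ 0) : j = o ∨ rank i < rank j :=
    (hrank i j (DiGraph.adj_of_mul_edgeWeight_ne_zero h)).imp_left Subtype.ext
  obtain ⟨x, y, hx, hy0, hxo, hyo, hKx, hyK, hbound⟩ := exists_eigenvectors
    (k := vertsKernel H W r) (rank := fun i => rank i)
    (fun i j => ENNReal.mul_ne_top ENNReal.coe_ne_top (DiGraph.edgeWeight_ne_top _ _))
    hKrank (hH.reflTransGen_vertsKernel hW hr) ((returnSum_vertsKernel hW).trans hgen)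
  set Z := ∑ i, y i * x i with hZ
  have hZpos : 0 < Z := Finset.sum_pos' (fun i _ => mul_nonneg (hy0 i) (hx i).le)
    ⟨o, Finset.mem_univ o, by simp [hxo, hyo]⟩
  obtain ⟨μ, hμ, huniq, hval⟩ := exists_unique_isEquilibriumMeasure (H := H) (W := W) hW
    (r := r) (by positivity) (x := x) hx
    (P := fun i j => (vertsKernel H W r i j).toReal * x j / x i)
    (fun i j h => by
      rw [vertsKernel, DiGraph.edgeWeight_of_adj h, ENNReal.toReal_mul,
        ENNReal.toReal_ofReal (hW i j h).le, ENNReal.coe_toReal])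
    (fun i j h => by simp [vertsKernel, DiGraph.edgeWeight_of_not_adj h])
    (fun i => by rw [← Finset.sum_div, hKx, div_self (hx i).ne'])
    (π := fun i => y i * x i / Z)
    (fun i => div_nonneg (mul_nonneg (hy0 i) (hx i).le) hZpos.le)
    (by rw [← Finset.sum_div, ← hZ, div_self hZpos.ne'])
    (stationary_of_eigenvectors hx hyK)
    (fun π hπ1 hπ => eq_of_stationary (rank := fun i : H.verts => rank i)
      (fun i j h => hKrank i j fun h0 => h (by simp [h0])) hyo hyK hx hZpos.ne' hπ1 hπ)
  refine ⟨μ, hμ, huniq, fun L => ?_⟩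
  cases L with
  | zero => simp
  | succ L =>
    have := hμ.1.1
    rw [← ofReal_measureReal, hval o, hxo, hyo, one_mul, one_div, ENNReal.ofReal_inv_of_pos hZpos,
      inv_inv, ← tsum_vertsKernel_mul_passageTail hW]
    exact hbound L

end Recurrence

section RankedGraph

variable {V : Type*} {H : DiGraph V} {rank : V → ℕ} {o : V}

lemma exists_eq_of_mem_pathSpace (hrank : ∀ i j, H.Adj i j → j = o ∨ rank i < rank j)
    {ω : ℤ → V} (hω : ω ∈ H.pathSpace) (a : ℤ) : ∃ j ≤ rank (ω a), ω (a - j) = o := by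
  by_contra! hne
  have hdec : ∀ j ≤ rank (ω a) + 1, rank (ω (a - j)) + j ≤ rank (ω a) := by
    intro j
    induction j with
    | zero => simp
    | succ j ih =>
      intro hj
      have hstep : H.Adj (ω (a - (j + 1 : ℕ))) (ω (a - j)) := by
        convert hω (a - (j + 1 : ℕ)) using 2
        push_cast
        ring
      have := (hrank _ _ hstep).resolve_left (hne j (by omega))
      have := ih (by omega)
      omega
  have := hdec _ le_rfl
  omega

lemma measure_cylinder_le [MeasurableSpace V] [MeasurableSingletonClass V]
    {μ : Measure (ℤ → V)} (hμ : μ ∈ invariantMeasures H)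
    (hrank : ∀ i j, H.Adj i j → j = o ∨ rank i < rank j) {n : ℕ} (a : ℤ) (w : Fin (n + 1) → V) :
    μ (cylinder a w) ≤ (rank (w 0) + 1 : ℕ) * μ (cylinder 0 fun _ : Fin 1 => o) := by
  have hcover : ∀ᵐ ω ∂μ, ω ∈ cylinder a w →
      ω ∈ ⋃ j ∈ Finset.range (rank (w 0) + 1), cylinder (a - j) fun _ : Fin 1 => o := by
    filter_upwards [hμ.2.2] with ω hpath hω
    obtain ⟨j, hj, hjo⟩ := exists_eq_of_mem_pathSpace hrank hpath a
    have h0 : ω a = w 0 := by simpa using hω 0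
    simp only [Set.mem_iUnion, Finset.mem_range]
    exact ⟨j, by rw [← h0]; omega, fun i => by simpa using hjo⟩
  calc μ (cylinder a w)
      ≤ μ (⋃ j ∈ Finset.range (rank (w 0) + 1), cylinder (a - j) fun _ : Fin 1 => o) :=
        measure_mono_ae hcover
    _ ≤ ∑ j ∈ Finset.range (rank (w 0) + 1), μ (cylinder (a - j) fun _ : Fin 1 => o) :=
        measure_biUnion_finset_le _ _
    _ = (rank (w 0) + 1 : ℕ) * μ (cylinder 0 fun _ : Fin 1 => o) := by
        simp [fun b => measure_cylinder_eq hμ.2.1 b fun _ : Fin 1 => o]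

end RankedGraph

lemma IsLinear.exists_cycleSubgraph_measure_cylinder_le {G : DiGraph ℕ} (hG : IsLinear G)
    {W : ℕ → ℕ → ℝ} (hW : ∀ i j, G.Adj i j → 0 < W i j) {R : ℝ≥0} (hR : G.genFun W 1 R ≤ 1)
    (hdiv : ∀ z : ℝ≥0, R < z → G.genFun W 1 z = ∞) {n : ℕ} (hn : 1 ≤ n) (K : ℕ) :
    ∃ m > n, ∃ μ, IsEquilibriumMeasure (G.cycleSubgraph 1 n m) W μ ∧
      (∀ ν, IsEquilibriumMeasure (G.cycleSubgraph 1 n m) W ν → ν = μ) ∧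
      ∀ (l : ℕ) (a : ℤ) (w : Fin (l + 1) → ℕ),
        μ (cylinder a w) ≤ (w 0 + 1 : ℕ) * (K : ℝ≥0∞)⁻¹ := by
  obtain ⟨B, hB⟩ := hG.exists_isReachBound
  obtain ⟨m, hm, r, hgen, L, hL⟩ := hG.exists_long_cycles hW hR hdiv hn K
  have hone : 1 ∈ (G.cycleSubgraph 1 n m).verts :=
    DiGraph.fst_mem _ (((hG.isSimpleCycle_straight le_rfl).cycleSubgraph (Or.inl hn)).2.2.2.1 0)
  have hrank (i j : ℕ) (h : (G.cycleSubgraph 1 n m).Adj i j) : j = 1 ∨ i < j :=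
    or_iff_not_imp_left.2 (hG.lt_of_adj (DiGraph.adj_of_cycleSubgraph h))
  obtain ⟨μ, hμ, huniq, hreturn⟩ := exists_isEquilibriumMeasure_inv_le (o := ⟨1, hone⟩)
    (rank := id) (IsLinear.finite_cycleSubgraph hB) DiGraph.isConnected_cycleSubgraph hrank
    (fun i j h => hW i j (DiGraph.adj_of_cycleSubgraph h)) hgen
  refine ⟨m, hm, μ, hμ, huniq, fun l a w => ?_⟩
  refine (measure_cylinder_le hμ.1 (rank := id) hrank a w).trans ?_
  gcongr
  · rfl
  · exact ENNReal.le_inv_iff_le_inv.2 ((hL.trans (hreturn L)).trans' (by simp))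

end LoadedGraph

end

theorem theorem1_general (G : LoadedGraph.DiGraph ℕ) (hG : LoadedGraph.IsLinear G)
    (W : ℕ → ℕ → ℝ) (hW : ∀ i j : ℕ, G.Adj i j → 0 < W i j) {v : ℕ} (hv : v ∈ G.verts)
    (h : G.genFun W v (G.convRadius W v) ≤ 1) :
    ∃ n : ℕ → ℕ, StrictMono n ∧ (∀ k, 1 ≤ n k) ∧
      LoadedGraph.IsIrregular G W (fun k => G.cycleSubgraph 1 (n k) (n (k + 1))) := by
  obtain ⟨B, hB⟩ := hG.exists_isReachBound
  obtain ⟨R, hR, hdiv⟩ := hG.isConnected.exists_critical_point hW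
    (G.fst_mem (hG.adj_one 1 le_rfl)) hv h
  choose f hf μ hμ huniq hle using fun (n : {n : ℕ // 1 ≤ n}) (K : ℕ) =>
    hG.exists_cycleSubgraph_measure_cylinder_le hW hR hdiv n.2 K
  let n (k : ℕ) : {n : ℕ // 1 ≤ n} := k.rec ⟨1, le_rfl⟩ fun k n => ⟨f n k, n.2.trans (hf n k).le⟩
  have hmono : StrictMono fun k => (n k).1 :=
    strictMono_nat_of_lt_succ fun k => hf (n k) k
  refine ⟨fun k => (n k).1, hmono, fun k => (n k).2, hG.isExhaustive_cycleSubgraph hmono,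
    fun k => ⟨LoadedGraph.IsLinear.finite_cycleSubgraph hB,
      LoadedGraph.DiGraph.isConnected_cycleSubgraph⟩,
    fun k => μ (n k) k, fun k => ⟨hμ (n k) k, huniq (n k) k⟩, fun l a w => ?_⟩
  have hlim : Tendsto (fun k : ℕ => ((w 0 + 1 : ℕ) : ℝ≥0∞) * (k : ℝ≥0∞)⁻¹) atTop (𝓝 0) := by
    simpa using ENNReal.Tendsto.const_mul ENNReal.tendsto_inv_nat_nhds_zero
      (Or.inr (ENNReal.natCast_ne_top (w 0 + 1)))
  exact tendsto_of_tendsto_of_tendsto_of_le_of_le tendsto_const_nhds hlim (fun _ => zero_le)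
    fun k => hle (n k) k l a w

theorem theorem1 (G : LoadedGraph.DiGraph ℕ) (hG : LoadedGraph.IsLinear G)
    (W : ℕ → ℕ → ℝ) (hW : ∀ i j : ℕ, G.Adj i j → 0 < W i j)
    (hU : G.IsUnstablePositive W) :
    ∃ n : ℕ → ℕ, StrictMono n ∧ (∀ k, 1 ≤ n k) ∧
      LoadedGraph.IsIrregular G W (fun k => G.cycleSubgraph 1 (n k) (n (k + 1))) := by
  obtain ⟨v, hv, h, -⟩ := hU
  exact theorem1_general G hG W hW hv h.le
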